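/- Let $\mathbb G$ be a Carnot group, i.e. a simply connected real Lie group whose Lie algebra is equipped with a stratification $\mathfrak g=V_1\oplus\dots\oplus V_s$, $[V_1,V_j]=V_{j+1}$ for all $j\ge 1$ (where $V_j=0$ for $j>s$). For $t>0$ let $\delta_t$ be the dilation, i.e. the Lie group automorphism of $\mathbb G$ whose differential is multiplication by $t$ on $V_1$. Fix a scalar product on $V_1$ and a Haar measure $\mathrm{vol}$ on $\mathbb G$. Let $\rho$ be the associated Carnot distance: $\rho(p,q)$ is the infimum of the lengths of the piecewise $C^1$ curves from $p$ to $q$ that are tangent to the left-invariant distribution generated by $V_1$. Write $B_\rho(x,r)$ for the open balls of $\rho$. Let $C\subseteq\mathbb G$ be an open cone, i.e. a non-empty open set with $\delta_t(C)=C$ for every $t>0$, and let $E\subseteq\mathbb G$ be a measurable set with the $C$-cone property $E\cdot C\subseteq E$. Let $$\tilde E=\Bigl\{x\in\mathbb G:\ \lim_{r\to0^+}\frac{\mathrm{vol}(B_\rho(x,r)\cap E)}{\mathrm{vol}(B_\rho(x,r))}=1\Bigr\}$$ be the Carnot–Lebesgue representative of $E$. Then: 1. $\tilde E$ is open and regularly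 open, that is, $\tilde E=\operatorname{Int}(\operatorname{Cl}(\tilde E))$; 2. if $E\neq\emptyset$, then $\tilde E$ is contractible; 3. if $E\neq\mathbb G$, then the complement $\mathbb G\setminus\tilde E$ is contractible. -/

import Mathlib

open Set Filter Topology MeasureTheory
open scoped Manifold ContDiff ENNReal Pointwise

noncomputable section

namespace Carnot

/-- A stratification `𝔤 = V 1 ⊕ V 2 ⊕ ⋯ ⊕ V s` of the Lie algebra of a real Lie group `G`:
`[V 1, V j] = V (j + 1)` for all `j ≥ 1`, with `V j = 0` for `j = 0` and for all `j > s`.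
Here `[V 1, V j]` is the linear span of the brackets. -/
structure IsStratification {E : Type*} [NormedAddCommGroup E] [NormedSpace ℝ E]
    {G : Type*} [TopologicalSpace G] [ChartedSpace E G] [Group G]
    (V : ℕ → Submodule ℝ (GroupLieAlgebra 𝓘(ℝ, E) G)) : Prop where
  layer_zero : V 0 = ⊥
  finite_step : ∃ s : ℕ, ∀ j, s < j → V j = ⊥
  isInternal : DirectSum.IsInternal V
  bracket_eq : ∀ j, 1 ≤ j →
    Submodule.span ℝ {z : GroupLieAlgebra 𝓘(ℝ, E) G | ∃ x ∈ V 1, ∃ y ∈ V j, ⁅x, y⁆ = z} = V (j + 1)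

/-- `φ` is the dilation of factor `t`: the Lie group automorphism whose differential is
multiplication by `t` on the first layer `V₁`, whose elements are seen as left-invariant vector
fields. -/
structure IsDilation {E : Type*} [NormedAddCommGroup E] [NormedSpace ℝ E]
    {G : Type*} [TopologicalSpace G] [ChartedSpace E G] [Group G]
    (V₁ : Submodule ℝ (GroupLieAlgebra 𝓘(ℝ, E) G)) (t : ℝ) (φ : G ≃* G) : Prop where
  smooth : ContMDiff 𝓘(ℝ, E) 𝓘(ℝ, E) ∞ φ
  smooth_symm : ContMDiff 𝓘(ℝ, E) 𝓘(ℝ, E) ∞ φ.symm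
  mfderiv_eq : ∀ v ∈ V₁, ∀ g : G,
    mfderiv 𝓘(ℝ, E) 𝓘(ℝ, E) φ g (mulInvariantVectorField v g) =
      t • mulInvariantVectorField v (φ g)

/-- A cone: a non-empty set `C` with `δ_t(C) = C` for all `t > 0`, where `δ_t` is the dilation of
factor `t` (which, on a simply connected group with stratified Lie algebra, exists and is unique,
so that the existential quantifier below is the usual description of `δ_t`). -/
def IsCone {E : Type*} [NormedAddCommGroup E] [NormedSpace ℝ E]
    {G : Type*} [TopologicalSpace G] [ChartedSpace E G] [Group G]
    (V₁ : Submodule ℝ (GroupLieAlgebra 𝓘(ℝ, E) G)) (C : Set G) : Prop :=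
  C.Nonempty ∧ ∀ t : ℝ, 0 < t → ∃ δ : G ≃* G, IsDilation V₁ t δ ∧ δ '' C = C

/-- The `C`-cone property of a set `A`: `A · C ⊆ A`. -/
def HasConeProperty {G : Type*} [Group G] (C A : Set G) : Prop :=
  A * C ⊆ A

/-- `γ`, restricted to `[0, 1]`, is a piecewise `C¹` curve tangent to the left-invariant
distribution induced by `V₁`, and `u s ∈ V₁` is its velocity at time `s`, read in the Lie algebra
by left translation. (At the finitely many break points there is no condition on `u`.) -/
structure IsHorizontalCurve {E : Type*} [NormedAddCommGroup E] [NormedSpace ℝ E]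
    {G : Type*} [TopologicalSpace G] [ChartedSpace E G] [Group G]
    (V₁ : Submodule ℝ (GroupLieAlgebra 𝓘(ℝ, E) G)) (γ : ℝ → G) (u : ℝ → V₁) : Prop where
  piecewise_C1 : ∃ (n : ℕ) (τ : ℕ → ℝ), Monotone τ ∧ τ 0 = 0 ∧ τ n = 1 ∧
    ∀ i < n, ContMDiffOn 𝓘(ℝ, ℝ) 𝓘(ℝ, E) 1 γ (Icc (τ i) (τ (i + 1)))
  velocity : ∀ s ∈ Ioo (0 : ℝ) 1, MDifferentiableAt 𝓘(ℝ, ℝ) 𝓘(ℝ, E) γ s →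
    mfderiv 𝓘(ℝ, ℝ) 𝓘(ℝ, E) γ s (1 : ℝ) =
      mulInvariantVectorField (u s : GroupLieAlgebra 𝓘(ℝ, E) G) (γ s)

/-- The length of a curve with (left-translated) velocity `u`, for the scalar product `B` on
`V₁`. -/
def curveLength {E : Type*} [NormedAddCommGroup E] [NormedSpace ℝ E]
    {G : Type*} [TopologicalSpace G] [ChartedSpace E G] [Group G]
    {V₁ : Submodule ℝ (GroupLieAlgebra 𝓘(ℝ, E) G)}
    (B : LinearMap.BilinForm ℝ V₁) (u : ℝ → V₁) : ℝ≥0∞ :=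
  ∫⁻ s in Icc (0 : ℝ) 1, ENNReal.ofReal (Real.sqrt (B (u s) (u s)))

/-- The Carnot distance: the infimum of the lengths of the horizontal curves from `p` to `q`. -/
def carnotEDist {E : Type*} [NormedAddCommGroup E] [NormedSpace ℝ E]
    {G : Type*} [TopologicalSpace G] [ChartedSpace E G] [Group G]
    {V₁ : Submodule ℝ (GroupLieAlgebra 𝓘(ℝ, E) G)}
    (B : LinearMap.BilinForm ℝ V₁) (p q : G) : ℝ≥0∞ :=
  ⨅ (γ : ℝ → G) (u : ℝ → V₁) (_ : IsHorizontalCurve V₁ γ u ∧ γ 0 = p ∧ γ 1 = q), curveLength B u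

/-- The open ball of the Carnot distance. -/
def carnotBall {E : Type*} [NormedAddCommGroup E] [NormedSpace ℝ E]
    {G : Type*} [TopologicalSpace G] [ChartedSpace E G] [Group G]
    {V₁ : Submodule ℝ (GroupLieAlgebra 𝓘(ℝ, E) G)}
    (B : LinearMap.BilinForm ℝ V₁) (x : G) (r : ℝ) : Set G :=
  {y | carnotEDist B x y < ENNReal.ofReal r}

/-- The Carnot–Lebesgue representative of `A`: the set of points of density one of `A` with
respect to the Carnot distance and the measure `μ`. -/
def lebesgueRepresentative {E : Type*} [NormedAddCommGroup E] [NormedSpace ℝ E]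
    {G : Type*} [TopologicalSpace G] [ChartedSpace E G] [Group G] [MeasurableSpace G]
    {V₁ : Submodule ℝ (GroupLieAlgebra 𝓘(ℝ, E) G)}
    (B : LinearMap.BilinForm ℝ V₁) (μ : Measure G) (A : Set G) : Set G :=
  {x | Tendsto (fun r : ℝ => μ (carnotBall B x r ∩ A) / μ (carnotBall B x r)) (𝓝[>] 0) (𝓝 1)}

end Carnot

end

/-!
Write `D_t` for the dilation of factor `t`, with `D_0` the trivial endomorphism. Three elementary
facts about a set `A` with `A C ⊆ A` drive the proof.

* If `x` is not interior to `A`, then `x C⁻¹` does not meet `A`, because `a ∈ A ∩ x C⁻¹` puts `x` in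
  the open subset `a C` of `A`. The set `x C⁻¹` is invariant under the dilations centred at `x`, so
  it occupies the same positive proportion of every ball centred at `x`, and `x` is not a point of
  density one. Hence the Lebesgue representative of `A` is its interior
  (`lebesgueRepresentative_eq_interior`). In particular it is open, and it has the cone property.
* Since `C` accumulates at `1`, the interior of `A` is regularly open
  (`HasConeProperty.interior_closure_interior`).
* A non-empty set `S` with `S C ⊆ S` is contractible (`IsContractingFamily.contractibleSpace`).
  Pushing a point `x` of `S` by `D_t c`, with `c ∈ C` fixed and `t` large depending on `x`, moves it
  inside `x C ⊆ S` to a place from which it can be slid to `x₀ D_t c` within `x₀ C ⊆ S`, because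
  `D_{1/t}` of the displacement from `x₀` is small and `C` is open. This applies to the interior of
  `A` with the cone `C`, and to its complement with the cone `C⁻¹` (`HasConeProperty.compl`).

The work lies in the geometry that these arguments take for granted: that the Carnot balls are
neighbourhoods of their centres and are small when the radius is small, and that `D_t x` depends
continuously on `(t, x) ∈ [0, ∞) × G`.

That balls are neighbourhoods (`exists_eventually_isSteerable`) is the theorem of Chow for
stratified groups. Let `H` be the subgroup generated by the one-parameter subgroups of horizontal
vectors. The span of the vectors `Ad h v`, with `h ∈ H` and `v` horizontal, is invariant under
`Ad H`. Differentiating `Ad` along horizontal one-parameter subgroups shows that it is stable under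
brackets with horizontal vectors, so by the stratification it is the whole Lie algebra
(`adjointSpan_eq_top`). Therefore a finite product of curves `t ↦ h exp (t v) h⁻¹` is a submersion
at `0`, and its values are end points of horizontal curves of bounded length. In particular `H` is
open, so `H = G` by connectedness. The derivative of `Ad` is computed from the second derivative of
the multiplication in a chart at the identity (`bracket_eq_chartHessian`, `hasDerivAt_Ad`).

That small balls are small (`exists_carnotBall_subset`) follows by integrating the derivative of a
bump function along horizontal curves. Dilations are determined on horizontal one-parameter
subgroups, where `D_t exp (s v) = exp (t s v)`; as these generate `G`, the maps `t ↦ D_t x` are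
continuous and `D_s D_t = D_{st}`. Dilations scale the Carnot distance, and the comparison of the
distance with the topology turns this into joint continuity
(`isContractingFamily_dilationFamily`).
-/

namespace Carnot

/-! ### Velocities of curves and one-parameter subgroups -/

section Basic

set_option linter.unusedSectionVars false

variable {E : Type*} [NormedAddCommGroup E] [NormedSpace ℝ E]
  {G : Type*} [TopologicalSpace G] [ChartedSpace E G] [Group G]

/-- The curve `γ` is differentiable at time `s` and its velocity there is the value at `γ s` of the
left-invariant vector field `v`. -/
def HasVelocityAt (γ : ℝ → G) (v : GroupLieAlgebra 𝓘(ℝ, E) G) (s : ℝ) : Prop :=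
  HasMFDerivAt 𝓘(ℝ, ℝ) 𝓘(ℝ, E) γ s
    ((1 : ℝ →L[ℝ] ℝ).smulRight (mulInvariantVectorField v (γ s)))

variable [LieGroup 𝓘(ℝ, E) ∞ G]

theorem mfderiv_mul_left_mulInvariantVectorField (g h : G) (v : GroupLieAlgebra 𝓘(ℝ, E) G) :
    mfderiv 𝓘(ℝ, E) 𝓘(ℝ, E) (g * ·) h (mulInvariantVectorField v h)
      = mulInvariantVectorField v (g * h) := by
  have e : (fun x => g * h * x) = (fun x => g * x) ∘ (fun x : G => h * x) := by
    ext x; simp [mul_assoc]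
  have d : ∀ a b : G, MDifferentiableAt 𝓘(ℝ, E) 𝓘(ℝ, E) (a * ·) b := fun a b =>
    (contMDiff_mul_left (I := 𝓘(ℝ, E)) (n := ∞)).contMDiffAt.mdifferentiableAt (by simp)
  unfold mulInvariantVectorField
  rw [e, mfderiv_comp (I' := 𝓘(ℝ, E)) _ (d _ _) (d _ _)]
  -- The base points `h * 1` and `h` are not definitionally equal, but all tangent spaces are `E`.
  have key : ∀ k, k = h → ∀ x : E, (mfderiv 𝓘(ℝ, E) 𝓘(ℝ, E) (g * ·) h : E →L[ℝ] E) x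
      = (mfderiv 𝓘(ℝ, E) 𝓘(ℝ, E) (g * ·) k : E →L[ℝ] E) x := by
    rintro _ rfl _; rfl
  exact key _ (mul_one h) _

theorem HasVelocityAt.mul_left (g : G) {γ : ℝ → G} {v : GroupLieAlgebra 𝓘(ℝ, E) G} {s : ℝ}
    (h : HasVelocityAt γ v s) : HasVelocityAt (fun s => g * γ s) v s := by
  have d : MDifferentiableAt 𝓘(ℝ, E) 𝓘(ℝ, E) (g * ·) (γ s) :=
    (contMDiff_mul_left (I := 𝓘(ℝ, E)) (n := ∞)).contMDiffAt.mdifferentiableAt (by simp)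
  have := d.hasMFDerivAt.comp s h
  refine this.congr_mfderiv (ContinuousLinearMap.ext fun r : ℝ => ?_)
  have e := mfderiv_mul_left_mulInvariantVectorField g (γ s) v
  exact ((mfderiv 𝓘(ℝ, E) 𝓘(ℝ, E) (g * ·) (γ s)).map_smul r _).trans
      (congrArg (fun x : E => r • x) e)

theorem HasVelocityAt.comp {γ : ℝ → G} {v : GroupLieAlgebra 𝓘(ℝ, E) G} {θ : ℝ → ℝ} {a s : ℝ}
    (h : HasVelocityAt γ v (θ s)) (hθ : HasDerivAt θ a s) :
    HasVelocityAt (fun s => γ (θ s)) (a • v) s := by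
  have := HasMFDerivAt.comp s h hθ.hasFDerivAt.hasMFDerivAt
  refine this.congr_mfderiv (ContinuousLinearMap.ext fun r : ℝ => ?_)
  rw [mulInvariantVectorField_smul]
  change ((r • a) : ℝ) • (mulInvariantVectorField v (γ (θ s)) : E) = r •
      (a • (mulInvariantVectorField v (γ (θ s)) : E))
  rw [smul_eq_mul, mul_smul]

/-- A dilation multiplies horizontal velocities by its factor. -/
theorem IsDilation.map_hasVelocityAt {V₁ : Submodule ℝ (GroupLieAlgebra 𝓘(ℝ, E) G)} {t : ℝ}
    {δ : G ≃* G}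
    (hδ : IsDilation V₁ t δ) {γ : ℝ → G} {v : GroupLieAlgebra 𝓘(ℝ, E) G} (hv : v ∈ V₁) {s : ℝ}
    (h : HasVelocityAt γ v s) : HasVelocityAt (fun s => δ (γ s)) (t • v) s := by
  have d : MDifferentiableAt 𝓘(ℝ, E) 𝓘(ℝ, E) δ (γ s) :=
    hδ.smooth.contMDiffAt.mdifferentiableAt (by simp)
  have := d.hasMFDerivAt.comp s h
  refine this.congr_mfderiv (ContinuousLinearMap.ext fun r : ℝ => ?_)
  have e := hδ.mfderiv_eq v hv (γ s)
  rw [mulInvariantVectorField_smul]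
  exact ((mfderiv 𝓘(ℝ, E) 𝓘(ℝ, E) δ (γ s)).map_smul r _).trans (congrArg (fun x : E => r • x) e)

theorem mulInvariantVectorField_one (v : GroupLieAlgebra 𝓘(ℝ, E) G) :
    mulInvariantVectorField v (1 : G) = v := by
  have e : (fun x : G => 1 * x) = id := by ext x; simp
  have : ∀ f : G → G, f = id → (mfderiv 𝓘(ℝ, E) 𝓘(ℝ, E) f 1 : E →L[ℝ] E) v = v := by
    rintro _ rfl
    rw [mfderiv_id]; rfl
  exact this _ e

section Exp

theorem contMDiff_one_mulInvariantVectorField (v : GroupLieAlgebra 𝓘(ℝ, E) G) :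
    ContMDiff 𝓘(ℝ, E) 𝓘(ℝ, E).tangent 1
      (fun g : G => (mulInvariantVectorField v g : TangentBundle 𝓘(ℝ, E) G)) := by
  have : LieGroup 𝓘(ℝ, E) (minSmoothness ℝ 3) G := by
    rw [minSmoothness_of_isRCLikeNormedField]; infer_instance
  have := contMDiff_mulInvariantVectorField v
  exact this.of_le (le_trans (by norm_num) (le_minSmoothness (n := 2)))

variable [T2Space G] [FiniteDimensional ℝ E]

/-- Left-invariant vector fields are complete: an integral curve through the identity on `(-ε, ε)`
is carried by left translations to one through any other point, with the same `ε`. -/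
theorem exists_oneParameter (v : GroupLieAlgebra 𝓘(ℝ, E) G) :
    ∃ γ : ℝ → G, γ 0 = 1 ∧ ∀ s, HasVelocityAt γ v s := by
  have hv := contMDiff_one_mulInvariantVectorField v
  obtain ⟨γ, h0, hγ⟩ := exists_isMIntegralCurveAt_of_contMDiffAt_boundaryless 0
    (hv.contMDiffAt (x := (1 : G)))
  obtain ⟨ε, hε, hγ⟩ := isMIntegralCurveAt_iff'.1 hγ
  have hb : ∀ s ∈ Ioo (-ε) ε, Metric.ball (0 : ℝ) ε ∈ 𝓝 s := fun s hs =>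
    Metric.isOpen_ball.mem_nhds (by simpa [Real.ball_eq_Ioo] using hs)
  obtain ⟨γ', h, h'⟩ := exists_isMIntegralCurve_of_isMIntegralCurveOn hv hε
      (fun x => ⟨fun s => x * γ s, by simp [h0], fun s hs => HasMFDerivAt.hasMFDerivWithinAt <|
    HasVelocityAt.mul_left x ((hγ s (by simpa [Real.ball_eq_Ioo] using hs)).hasMFDerivAt
    (hb s hs))⟩) 1
  · exact ⟨γ', h, h'⟩

/-- The one-parameter subgroup `s ↦ exp (s v)`, defined as the integral curve of the left-invariant
vector field `v` that starts at the identity. -/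
noncomputable def lexp (v : GroupLieAlgebra 𝓘(ℝ, E) G) : ℝ → G := (exists_oneParameter v).choose

theorem lexp_zero (v : GroupLieAlgebra 𝓘(ℝ, E) G) : lexp v 0 = 1 :=
  (exists_oneParameter v).choose_spec.1

theorem hasVelocityAt_lexp (v : GroupLieAlgebra 𝓘(ℝ, E) G) (s : ℝ) : HasVelocityAt (lexp v) v s :=
  (exists_oneParameter v).choose_spec.2 s

theorem eq_lexp {v : GroupLieAlgebra 𝓘(ℝ, E) G} {γ : ℝ → G} (h0 : γ 0 = 1)
    (h : ∀ s, HasVelocityAt γ v s) : γ = lexp v :=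
  isMIntegralCurve_Ioo_eq_of_contMDiff_boundaryless (t₀ := 0)
    (contMDiff_one_mulInvariantVectorField v) h (hasVelocityAt_lexp v) (by rw [h0, lexp_zero])

theorem lexp_smul (v : GroupLieAlgebra 𝓘(ℝ, E) G) (a b : ℝ) :
    lexp (a • v) b = lexp v (a * b) := by
  have := eq_lexp (v := a • v) (γ := fun s => lexp v (a * s)) (by simp [lexp_zero]) fun s => by
    simpa using HasVelocityAt.comp (s := s) (hasVelocityAt_lexp v (a * s))
        ((hasDerivAt_id s).const_mul a)
  rw [← congrFun this b]

theorem IsDilation.map_lexp {V₁ : Submodule ℝ (GroupLieAlgebra 𝓘(ℝ, E) G)} {t : ℝ} {δ : G ≃* G}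
    (hδ : IsDilation V₁ t δ) {v : GroupLieAlgebra 𝓘(ℝ, E) G} (hv : v ∈ V₁) (s : ℝ) :
    δ (lexp v s) = lexp v (t * s) := by
  rw [← lexp_smul]
  exact congrFun (eq_lexp (γ := fun s => δ (lexp v s)) (by simp [lexp_zero])
    fun s => hδ.map_hasVelocityAt hv (hasVelocityAt_lexp v s)) s

/-- A curve with velocity `v` is `C¹`: in the trivialization of the tangent bundle at a point of the
curve its derivative is the coordinate expression of `v`, which is continuous. -/
theorem contMDiff_lexp (v : GroupLieAlgebra 𝓘(ℝ, E) G) :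
    ContMDiff 𝓘(ℝ, ℝ) 𝓘(ℝ, E) 1 (lexp v) := by
  intro t₀
  have hc : Continuous (lexp v) :=
    continuous_iff_continuousAt.2 fun s => (hasVelocityAt_lexp v s).continuousAt
  have hi : IsMIntegralCurve (lexp v) (mulInvariantVectorField v) := hasVelocityAt_lexp v
  have hd := (hi.isMIntegralCurveAt t₀).eventually_hasDerivAt
  let e := trivializationAt E (TangentSpace 𝓘(ℝ, E) : G → Type _) (lexp v t₀)
  have he : ContMDiffOn 𝓘(ℝ, E) 𝓘(ℝ, E) 1
      (fun x => (e ⟨x, mulInvariantVectorField v x⟩).2) e.baseSet :=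
    (e.contMDiffOn_section_iff e.open_baseSet subset_rfl).1
      (contMDiff_one_mulInvariantVectorField v).contMDiffOn
  have hm : lexp v t₀ ∈ e.baseSet := FiberBundle.mem_baseSet_trivializationAt' _
  rw [contMDiffAt_iff]
  refine ⟨hc.continuousAt, ContDiffAt.contDiffWithinAt ?_⟩
  refine contDiffAt_one_iff.2 ⟨fun t => (1 : ℝ →L[ℝ] ℝ).smulRight
    ((e ⟨lexp v t, mulInvariantVectorField v (lexp v t)⟩).2 : E), _,
    inter_mem hd (hc.continuousAt.preimage_mem_nhds (e.open_baseSet.mem_nhds hm)), ?_, ?_⟩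
  · have h1 : ContinuousOn (fun t => ((e ⟨lexp v t, mulInvariantVectorField v (lexp v t)⟩).2 : E))
        (lexp v ⁻¹' e.baseSet) := he.continuousOn.comp hc.continuousOn fun _ h => h
    exact ((ContinuousLinearMap.smulRightL ℝ ℝ E 1).continuous.comp_continuousOn h1).mono
        inter_subset_right
  · intro t ht
    exact ht.1.hasFDerivAt

end Exp

end Basic

/-! ### The adjoint representation, read in a chart -/

section Adjoint
set_option linter.unusedSectionVars false

variable {E : Type*} [NormedAddCommGroup E] [NormedSpace ℝ E]
  {G : Type*} [TopologicalSpace G] [ChartedSpace E G] [Group G]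

variable (E G) in
/-- The chart of `G` at the identity. -/
noncomputable def chart : PartialEquiv G E := extChartAt 𝓘(ℝ, E) (1 : G)

variable (E G) in
/-- The coordinates of the identity in the chart at the identity. -/
noncomputable def chartOne : E := chart E G 1

variable (G) in
/-- The group multiplication read in the chart at the identity; meaningful near
`(chartOne E G, chartOne E G)`. -/
noncomputable def chartMul (p : E × E) : E :=
    chart E G ((chart E G).symm p.1 * (chart E G).symm p.2)

/-- The conjugation `x ↦ g x g⁻¹` read in the chart at the identity; meaningful near
`chartOne E G`. -/
noncomputable def chartConj (g : G) (x : E) : E :=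
  chart E G (g * (chart E G).symm x * g⁻¹)

variable (E) in
/-- The adjoint representation: the differential at the identity of the conjugation by `g`. The Lie
algebra is `E` itself, since the chart at the identity has the identity as its differential
(`mfderiv_chart_one`). -/
noncomputable def Ad (g : G) : E →L[ℝ] E := fderiv ℝ (chartConj (E := E) g) (chartOne E G)

variable [LieGroup 𝓘(ℝ, E) ∞ G]

theorem contMDiffAt_chart {g : G} (hg : g ∈ (chart E G).source) :
    ContMDiffAt 𝓘(ℝ, E) 𝓘(ℝ, E) ∞ (chart E G) g :=
  contMDiffAt_extChartAt' (by simpa [chart] using hg)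

theorem contMDiffAt_chart_symm {x : E} (hx : x ∈ (chart E G).target) :
    ContMDiffAt 𝓘(ℝ, E) 𝓘(ℝ, E) ∞ (chart E G).symm x :=
  (contMDiffOn_extChartAt_symm (1 : G)).contMDiffAt ((isOpen_extChartAt_target (1 : G)).mem_nhds hx)

theorem chartOne_mem_target : chartOne E G ∈ (chart E G).target := mem_extChartAt_target _

theorem chart_symm_chartOne : (chart E G).symm (chartOne E G) = 1 := extChartAt_to_inv _

theorem chart_one : chart E G 1 = chartOne E G := rfl

theorem chart_source_mem_nhds : (chart E G).source ∈ 𝓝 1 := extChartAt_source_mem_nhds _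

theorem one_mem_chart_source : 1 ∈ (chart E G).source := mem_extChartAt_source _

theorem eventually_chart_mem : ∀ᶠ x in 𝓝 (chartOne E G), x ∈ (chart E G).target :=
  (isOpen_extChartAt_target (I := 𝓘(ℝ, E)) (1 : G)).mem_nhds chartOne_mem_target

theorem contDiffAt_chartMul {p : E × E} (h1 : p.1 ∈ (chart E G).target)
    (h2 : p.2 ∈ (chart E G).target)
    (h : (chart E G).symm p.1 * (chart E G).symm p.2 ∈ (chart E G).source) :
    ContDiffAt ℝ ∞ (chartMul (E := E) G) p := by
  rw [← contMDiffAt_iff_contDiffAt]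
  have a1 : ContMDiffAt 𝓘(ℝ, E × E) 𝓘(ℝ, E) ∞ (fun p : E × E => (chart E G).symm p.1) p :=
    (contMDiffAt_chart_symm h1).comp p contDiffAt_fst.contMDiffAt
  have a2 : ContMDiffAt 𝓘(ℝ, E × E) 𝓘(ℝ, E) ∞ (fun p : E × E => (chart E G).symm p.2) p :=
    (contMDiffAt_chart_symm h2).comp p contDiffAt_snd.contMDiffAt
  exact (contMDiffAt_chart h).comp p (a1.mul a2)

theorem contDiffAt_chartConj (g : G) : ContDiffAt ℝ ∞ (chartConj (E := E) g) (chartOne E G) := by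
  rw [← contMDiffAt_iff_contDiffAt]
  have a1 : ContMDiffAt 𝓘(ℝ, E) 𝓘(ℝ, E) ∞ (fun p : E => (chart E G).symm p) (chartOne E G) :=
    contMDiffAt_chart_symm chartOne_mem_target
  refine ContMDiffAt.comp (I' := 𝓘(ℝ, E)) (g := chart E G) _ (contMDiffAt_chart ?_)
      ((contMDiffAt_const.mul a1).mul contMDiffAt_const)
  simp [chart_symm_chartOne, one_mem_chart_source]

theorem hasFDerivAt_chartConj (g : G) :
    HasFDerivAt (chartConj (E := E) g) (Ad E g) (chartOne E G) :=
  ((contDiffAt_chartConj g).differentiableAt (by simp)).hasFDerivAt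

theorem chartConj_chartOne (g : G) : chartConj (E := E) g (chartOne E G) = chartOne E G := by
  simp [chartConj, chart_symm_chartOne, chart_one]

theorem continuousAt_chart_symm : ContinuousAt (chart E G).symm (chartOne E G) :=
  (contMDiffAt_chart_symm chartOne_mem_target).continuousAt

theorem Ad_one : Ad E (1 : G) = ContinuousLinearMap.id ℝ E := by
  have : chartConj (E := E) (1 : G) =ᶠ[𝓝 (chartOne E G)] id := by
    filter_upwards [eventually_chart_mem (E := E) (G := G)] with x hx
    simp [chartConj, (chart E G).right_inv hx]
  rw [Ad, this.fderiv_eq, fderiv_id]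

theorem eventually_conj_mem (g : G) :
    ∀ᶠ x in 𝓝 (chartOne E G), g * (chart E G).symm x * g⁻¹ ∈ (chart E G).source := by
  have ht : IsTopologicalGroup G := topologicalGroup_of_lieGroup 𝓘(ℝ, E) ∞
  have : ContinuousAt (fun x => g * (chart E G).symm x * g⁻¹) (chartOne E G) :=
    (continuousAt_const.mul continuousAt_chart_symm).mul continuousAt_const
  apply this
  simpa [chart_symm_chartOne] using chart_source_mem_nhds (E := E) (G := G)

theorem Ad_mul (g h : G) : Ad E (g * h) = (Ad E g).comp (Ad E h) := by
  have : chartConj (E := E) (g * h) =ᶠ[𝓝 (chartOne E G)] chartConj g ∘ chartConj h := by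
    filter_upwards [eventually_conj_mem h] with x hx
    simp only [chartConj, Function.comp_apply, (chart E G).left_inv hx]
    simp [mul_assoc]
  rw [Ad, this.fderiv_eq]
  refine HasFDerivAt.fderiv (HasFDerivAt.comp _ ?_ (hasFDerivAt_chartConj h))
  rw [chartConj_chartOne]
  exact hasFDerivAt_chartConj g

theorem contDiffAt_chartMul_left {x : E} (hx : x ∈ (chart E G).target) :
    ContDiffAt ℝ ∞ (chartMul (E := E) G) (x, chartOne E G) :=
  contDiffAt_chartMul hx chartOne_mem_target (by
    simpa [chart_symm_chartOne] using (chart E G).map_target hx)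

theorem contDiffAt_chartMul_right {x : E} (hx : x ∈ (chart E G).target) :
    ContDiffAt ℝ ∞ (chartMul (E := E) G) (chartOne E G, x) :=
  contDiffAt_chartMul chartOne_mem_target hx (by
    simpa [chart_symm_chartOne] using (chart E G).map_target hx)

/-- The identity `g y = (g y g⁻¹) g`, differentiated in `y` at the identity: left and right
translations by `g` differ by `Ad g`. -/
theorem fderiv_chartMul_Ad {x : E} (hx : x ∈ (chart E G).target) (w : E) :
    fderiv ℝ (chartMul G) (x, chartOne E G) (0, w) =
      fderiv ℝ (chartMul G) (chartOne E G, x) (Ad E ((chart E G).symm x) w, 0) := by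
  set g := (chart E G).symm x
  have h1 : HasFDerivAt (fun y => chartMul G (x, y)) ((fderiv ℝ (chartMul G) (x, chartOne E G)).comp
      (.inr ℝ E E)) (chartOne E G) :=
    ((contDiffAt_chartMul_left hx).differentiableAt (by simp)).hasFDerivAt.comp _
      (hasFDerivAt_prodMk_right x _)
  have h2 : HasFDerivAt (fun y => chartMul G (y, x)) ((fderiv ℝ (chartMul G) (chartOne E G, x)).comp
      (.inl ℝ E E)) (chartConj g (chartOne E G)) := by
    rw [chartConj_chartOne]
    exact HasFDerivAt.comp (f := fun y => (y, x)) (chartOne E G)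
      ((contDiffAt_chartMul_right hx).differentiableAt (by simp)).hasFDerivAt
      (hasFDerivAt_prodMk_left (chartOne E G) x)
  have h3 := h2.comp _ (hasFDerivAt_chartConj g)
  have : (fun y => chartMul G (x, y)) =ᶠ[𝓝 (chartOne E G)]
      (fun y => chartMul G (y, x)) ∘ chartConj g := by
    filter_upwards [eventually_conj_mem g] with y hy
    simp [chartMul, chartConj, (chart E G).left_inv hy, g]
  have := congrArg (fun f : E →L[ℝ] E => f w) (h1.unique (h3.congr_of_eventuallyEq this))
  simpa using this

theorem fderiv_chartMul_right_one (w : E) :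
    fderiv ℝ (chartMul G) (chartOne E G, chartOne E G) (w, 0) = w := by
  have h2 : HasFDerivAt (fun y => chartMul G (y, chartOne E G))
      ((fderiv ℝ (chartMul G) (chartOne E G, chartOne E G)).comp
      (.inl ℝ E E)) (chartOne E G) :=
    HasFDerivAt.comp (f := fun y => (y, chartOne E G)) (chartOne E G)
      ((contDiffAt_chartMul_right chartOne_mem_target).differentiableAt (by simp)).hasFDerivAt
      (hasFDerivAt_prodMk_left (chartOne E G) (chartOne E G))
  have : (fun y => chartMul G (y, chartOne E G)) =ᶠ[𝓝 (chartOne E G)] id := by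
    filter_upwards [eventually_chart_mem (E := E) (G := G)] with y hy
    simp [chartMul, chart_symm_chartOne, (chart E G).right_inv hy]
  have := congrArg (fun f : E →L[ℝ] E => f w)
      (h2.unique ((hasFDerivAt_id _).congr_of_eventuallyEq this))
  simpa using this

theorem mfderiv_chart_one : (mfderiv 𝓘(ℝ, E) 𝓘(ℝ, E) (chart E G) 1 : E →L[ℝ] E) =
    ContinuousLinearMap.id ℝ E := by
  ext w
  have h : (1 : G) ∈ (chartAt E (1 : G)).source := mem_chart_source E 1
  have := mfderiv_chartAt_eq_tangentCoordChange (I := 𝓘(ℝ, E)) (x := (1 : G)) (y := 1) h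
  exact (congrArg (fun f : E →L[ℝ] E => f w) this).trans
    (tangentCoordChange_self (by simp))

theorem mfderiv_chart_symm_one :
    (mfderiv 𝓘(ℝ, E) 𝓘(ℝ, E) (chart E G).symm (chartOne E G) : E →L[ℝ] E) =
      ContinuousLinearMap.id ℝ E := by
  have h1 := ((contMDiffAt_chart (E := E) (G := G) (g := (chart E G).symm (chartOne E G))
    (by rw [chart_symm_chartOne]; exact one_mem_chart_source)).mdifferentiableAt
    (by simp)).hasMFDerivAt
  have h2 := ((contMDiffAt_chart_symm (E := E) (G := G) chartOne_mem_target).mdifferentiableAt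
      (by simp)).hasMFDerivAt
  have h3 := h1.comp _ h2
  have h4 : HasMFDerivAt 𝓘(ℝ, E) 𝓘(ℝ, E) (chart E G ∘ (chart E G).symm) (chartOne E G)
      (.id ℝ E) := by
    refine (hasMFDerivAt_id _).congr_of_eventuallyEq ?_
    filter_upwards [eventually_chart_mem (E := E) (G := G)] with y hy
    simp [(chart E G).right_inv hy]
  have h5 := hasMFDerivAt_unique h3 h4
  have key : ∀ k : G, k = 1 → (mfderiv 𝓘(ℝ, E) 𝓘(ℝ, E) (chart E G) k : E →L[ℝ] E) = .id ℝ E := by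
    rintro _ rfl
    exact mfderiv_chart_one
  ext w
  have h6 := congrArg (fun f : E →L[ℝ] E => f w) h5
  have h7 := congrArg (fun f : E →L[ℝ] E => f
    ((mfderiv 𝓘(ℝ, E) 𝓘(ℝ, E) (chart E G).symm (chartOne E G) : E →L[ℝ] E) w))
    (key _ (chart_symm_chartOne (E := E)))
  exact h7.symm.trans h6

/-- In the chart at the identity, the left-invariant vector field `w` is the partial derivative of
the multiplication in the second variable. -/
theorem mfderiv_chart_symm_chartMul {x : E} (hx : x ∈ (chart E G).target) (w : E) :
    (mfderiv 𝓘(ℝ, E) 𝓘(ℝ, E) (chart E G).symm x : E →L[ℝ] E)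
      (fderiv ℝ (chartMul G) (x, chartOne E G) (0, w)) =
    mulInvariantVectorField (G := G) (I := 𝓘(ℝ, E)) w ((chart E G).symm x) := by
  set g := (chart E G).symm x with hg
  have e1 : chartMul G (x, chartOne E G) = x := by
    simp [chartMul, chart_symm_chartOne, (chart E G).right_inv hx]
  have h1 : HasFDerivAt (fun y => chartMul G (x, y)) ((fderiv ℝ (chartMul G) (x, chartOne E G)).comp
      (.inr ℝ E E)) (chartOne E G) :=
    ((contDiffAt_chartMul_left hx).differentiableAt (by simp)).hasFDerivAt.comp _
      (hasFDerivAt_prodMk_right x _)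
  have h2 : HasMFDerivAt 𝓘(ℝ, E) 𝓘(ℝ, E) (chart E G).symm (chartMul G (x, chartOne E G))
      (mfderiv 𝓘(ℝ, E) 𝓘(ℝ, E) (chart E G).symm x : E →L[ℝ] E) := by
    rw [e1]
    exact ((contMDiffAt_chart_symm hx).mdifferentiableAt (by simp)).hasMFDerivAt
  have h3 := HasMFDerivAt.comp (f := fun y => chartMul G (x, y)) (chartOne E G) h2 h1.hasMFDerivAt
  have h4 : HasMFDerivAt 𝓘(ℝ, E) 𝓘(ℝ, E) (chart E G).symm (chartOne E G)
      (ContinuousLinearMap.id ℝ E) := by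
    have := ((contMDiffAt_chart_symm (E := E) (G := G) chartOne_mem_target).mdifferentiableAt
        (by simp)).hasMFDerivAt
    exact this.congr_mfderiv mfderiv_chart_symm_one
  have h5 : HasMFDerivAt 𝓘(ℝ, E) 𝓘(ℝ, E) (g * ·) ((chart E G).symm (chartOne E G))
      (mfderiv 𝓘(ℝ, E) 𝓘(ℝ, E) (g * ·) 1 : E →L[ℝ] E) := by
    rw [chart_symm_chartOne]
    exact ((contMDiff_mul_left (I := 𝓘(ℝ, E)) (n := ∞)).contMDiffAt.mdifferentiableAt
        (by simp)).hasMFDerivAt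
  have h6 := h5.comp _ h4
  have h7 : (g * ·) ∘ (chart E G).symm =ᶠ[𝓝 (chartOne E G)] (chart E G).symm ∘
      (fun y => chartMul G (x, y)) := by
    have ht : IsTopologicalGroup G := topologicalGroup_of_lieGroup 𝓘(ℝ, E) ∞
    have : ContinuousAt (fun x => g * (chart E G).symm x) (chartOne E G) :=
      continuousAt_const.mul continuousAt_chart_symm
    have h0 : g * (chart E G).symm (chartOne E G) ∈ (chart E G).source := by
      simpa [chart_symm_chartOne] using (chart E G).map_target hx
    filter_upwards [this ((isOpen_extChartAt_source (I := 𝓘(ℝ, E)) (1 : G)).mem_nhds h0)] with y hy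
    exact ((chart E G).left_inv hy).symm
  have h8 := hasMFDerivAt_unique (h3.congr_of_eventuallyEq h7) h6
  have := congrArg (fun f : E →L[ℝ] E => f w) h8
  exact this

end Adjoint

/-! ### The Lie bracket as the derivative of the adjoint representation -/

section Bracket
set_option linter.unusedSectionVars false

variable {E : Type*} [NormedAddCommGroup E] [NormedSpace ℝ E]
  {G : Type*} [TopologicalSpace G] [ChartedSpace E G] [Group G] [LieGroup 𝓘(ℝ, E) ∞ G]

variable (E G) in
/-- The second derivative at the identity of the multiplication read in the chart. -/
noncomputable def chartHessian : E × E →L[ℝ] E × E →L[ℝ] E :=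
  fderiv ℝ (fderiv ℝ (chartMul G)) (chartOne E G, chartOne E G)

theorem contDiffAt_chartMul_one :
    ContDiffAt ℝ ∞ (chartMul (E := E) G) (chartOne E G, chartOne E G) :=
  contDiffAt_chartMul_left chartOne_mem_target

theorem two_le_infty : (2 : ℕ∞ω) ≤ (∞ : ℕ∞ω) := ENat.LEInfty.out

theorem hasFDerivAt_fderiv_chartMul :
    HasFDerivAt (fderiv ℝ (chartMul G)) (chartHessian E G) (chartOne E G, chartOne E G) :=
  ((contDiffAt_chartMul_one.fderiv_right (m := 1) two_le_infty).differentiableAt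
  (by simp)).hasFDerivAt

theorem chartHessian_symm (p q : E × E) : chartHessian E G p q = chartHessian E G q p :=
  (contDiffAt_chartMul_one.isSymmSndFDerivAt (by simpa using two_le_infty)).eq p q

theorem mpullback_chart_symm {x : E} (hx : x ∈ (chart E G).target) (w : E) :
    (VectorField.mpullback 𝓘(ℝ, E) 𝓘(ℝ, E) (chart E G).symm
      (mulInvariantVectorField (G := G) (I := 𝓘(ℝ, E)) w) x : E) =
    fderiv ℝ (chartMul G) (x, chartOne E G) (0, w) := by
  rw [VectorField.mpullback_apply, ← mfderiv_chart_symm_chartMul hx w]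
  have := isInvertible_mfderivWithin_extChartAt_symm (I := 𝓘(ℝ, E)) (x := (1 : G)) (y := x) hx
  rw [ModelWithCorners.range_eq_univ, mfderivWithin_univ] at this
  exact (ContinuousLinearMap.IsInvertible.inverse_apply_eq this).2 rfl

/-- The bracket of the Lie algebra is the antisymmetric part of the second derivative of the
multiplication. -/
theorem bracket_eq_chartHessian (v w : GroupLieAlgebra 𝓘(ℝ, E) G) :
    (⁅v, w⁆ : GroupLieAlgebra 𝓘(ℝ, E) G) =
      (chartHessian E G (v, 0) (0, w) - chartHessian E G (w, 0) (0, v) : E) := by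
  have hf : ∀ w : E, HasFDerivAt (fun x => fderiv ℝ (chartMul G) (x, chartOne E G) (0, w))
      (((ContinuousLinearMap.apply ℝ E ((0 : E), w)).comp (chartHessian E G)).comp (.inl ℝ E E))
      (chartOne E G) := by
    intro w
    exact HasFDerivAt.comp (f := fun x => (x, chartOne E G)) (chartOne E G)
      (((ContinuousLinearMap.apply ℝ E ((0 : E), w)).hasFDerivAt).comp _
      hasFDerivAt_fderiv_chartMul)
       (hasFDerivAt_prodMk_left _ _)
  have he : ∀ w : E, (VectorField.mpullback 𝓘(ℝ, E) 𝓘(ℝ, E) (chart E G).symm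
      (mulInvariantVectorField (G := G) (I := 𝓘(ℝ, E)) w) : E → E) =ᶠ[𝓝 (chartOne E G)]
      fun x => fderiv ℝ (chartMul G) (x, chartOne E G) (0, w) := by
    intro w
    filter_upwards [eventually_chart_mem (E := E) (G := G)] with x hx
    exact mpullback_chart_symm hx w
  have hl : ∀ v w : E, VectorField.lieBracket ℝ
      (VectorField.mpullback 𝓘(ℝ, E) 𝓘(ℝ, E) (chart E G).symm
      (mulInvariantVectorField (G := G) (I := 𝓘(ℝ, E)) v) : E → E)
      (VectorField.mpullback 𝓘(ℝ, E) 𝓘(ℝ, E) (chart E G).symm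
      (mulInvariantVectorField (G := G) (I := 𝓘(ℝ, E)) w) : E → E) (chartOne E G) =
      chartHessian E G (v, 0) (0, w) - chartHessian E G (w, 0) (0, v) := by
    intro v w
    have hz : ∀ w : E, fderiv ℝ (chartMul G) (chartOne E G, chartOne E G) (0, w) = w := by
      intro w
      simpa [chart_symm_chartOne, Ad_one, fderiv_chartMul_right_one] using
        fderiv_chartMul_Ad (E := E) (G := G) chartOne_mem_target w
    rw [(he v).lieBracket_vectorField_eq (he w), VectorField.lieBracket, (hf v).fderiv,
        (hf w).fderiv, hz, hz]
    simp
  rw [GroupLieAlgebra.bracket_def, ← VectorField.mlieBracketWithin_univ,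
    VectorField.mlieBracketWithin_apply, preimage_univ, univ_inter, ModelWithCorners.range_eq_univ,
    VectorField.mpullbackWithin_univ, VectorField.mpullbackWithin_univ]
  refine (ContinuousLinearMap.IsInvertible.inverse_apply_eq
    (isInvertible_mfderiv_extChartAt (mem_extChartAt_source (1 : G)))).2 ?_
  refine (congrFun (VectorField.lieBracketWithin_univ (𝕜 := ℝ) (E := E)) _).trans
      ((hl v w).trans ?_)
  exact (congrArg (fun f : E →L[ℝ] E =>
      f (chartHessian E G (v, 0) (0, w) - chartHessian E G (w, 0) (0, v)))
    (mfderiv_chart_one (E := E) (G := G))).symm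

/-- Along a curve leaving the identity with velocity `v`, the derivative of `Ad` applied to `w` is
the right-hand side of `bracket_eq_chartHessian`, that is `⁅v, w⁆`. By `fderiv_chartMul_Ad`,
`Ad (γ t)` is the differential of the left translation by `γ t` followed by the inverse of the
differential of the right translation, and both are differentiated at `t = 0`. -/
theorem hasDerivAt_Ad {γ : ℝ → G} {v : E} (h0 : γ 0 = 1)
    (hγ : HasDerivAt (fun t => chart E G (γ t)) v 0) (hc : ContinuousAt γ 0) (w : E)
    [CompleteSpace E] :
    HasDerivAt (fun t => Ad E (γ t) w)
      (chartHessian E G (v, 0) (0, w) - chartHessian E G (w, 0) (0, v)) 0 := by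
  set A : ℝ → E →L[ℝ] E := fun t => (fderiv ℝ (chartMul G) (chartOne E G, chart E G (γ t))).comp
      (.inl ℝ E E)
  set F : ℝ → E := fun t => fderiv ℝ (chartMul G) (chart E G (γ t), chartOne E G) (0, w)
  have hx0 : (chartOne E G, chart E G (γ 0)) = (chartOne E G, chartOne E G) := by
    rw [h0, chart_one]
  have hx1 : (chart E G (γ 0), chartOne E G) = (chartOne E G, chartOne E G) := by
    rw [h0, chart_one]
  have hA : HasDerivAt A ((chartHessian E G (0, v)).comp (.inl ℝ E E)) 0 := by
    have h1 : HasDerivAt (fun t => (chartOne E G, chart E G (γ t))) ((0 : E), v) 0 :=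
      (hasDerivAt_const _ _).prodMk hγ
    have h2 : HasDerivAt (fun t => fderiv ℝ (chartMul G) (chartOne E G, chart E G (γ t)))
        (chartHessian E G (0, v)) 0 :=
      HasFDerivAt.comp_hasDerivAt (f := fun t => (chartOne E G, chart E G (γ t))) 0
        (by rw [hx0]; exact hasFDerivAt_fderiv_chartMul) h1
    simpa using h2.clm_comp (hasDerivAt_const (0 : ℝ) (ContinuousLinearMap.inl ℝ E E))
  have hF : HasDerivAt F (chartHessian E G (v, 0) (0, w)) 0 := by
    have h1 : HasDerivAt (fun t => (chart E G (γ t), chartOne E G)) (v, (0 : E)) 0 :=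
      hγ.prodMk (hasDerivAt_const _ _)
    have h2 : HasDerivAt (fun t => fderiv ℝ (chartMul G) (chart E G (γ t), chartOne E G))
        (chartHessian E G (v, 0)) 0 :=
      HasFDerivAt.comp_hasDerivAt (f := fun t => (chart E G (γ t), chartOne E G)) 0
        (by rw [hx1]; exact hasFDerivAt_fderiv_chartMul) h1
    simpa using h2.clm_apply (hasDerivAt_const (0 : ℝ) ((0 : E), w))
  have hA0 : A 0 = 1 := by
    ext u
    simp [A, h0, chart_one, fderiv_chartMul_right_one]
  have hs : ∀ᶠ t in 𝓝 0, γ t ∈ (chart E G).source :=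
    hc (by rw [h0]; exact chart_source_mem_nhds)
  have hev : ∀ t, γ t ∈ (chart E G).source → A t (Ad E (γ t) w) = F t := by
    intro t ht
    have := fderiv_chartMul_Ad ((chart E G).map_source ht) w
    rw [(chart E G).left_inv ht] at this
    exact this.symm
  have hF0 : F 0 = w := by
    rw [← hev 0 (by rw [h0]; exact one_mem_chart_source), hA0, h0, Ad_one]
    rfl
  -- Near `t = 0` the operator `A t` is invertible, and `Ad (γ t) w = (A t)⁻¹ (F t)`.
  have hinv : HasDerivAt (fun t => Ring.inverse (A t))
      (-((chartHessian E G (0, v)).comp (.inl ℝ E E))) 0 := by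
    have h1 := hasFDerivAt_ringInverse (𝕜 := ℝ) (1 : (E →L[ℝ] E)ˣ)
    rw [Units.val_one, ← hA0] at h1
    have := HasFDerivAt.comp_hasDerivAt 0 h1 hA
    refine this.congr_deriv ?_
    ext u
    simp
  have h := hinv.clm_apply hF
  have hev' : ∀ᶠ t in 𝓝 0, Ad E (γ t) w = Ring.inverse (A t) (F t) := by
    have hu : ∀ᶠ t in 𝓝 0, IsUnit (A t) :=
      hA.continuousAt (Units.isOpen.mem_nhds (by rw [hA0]; exact isUnit_one))
    filter_upwards [hs, hu] with t h1 h2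
    rw [← hev t h1, ← mul_apply_eq_comp, Ring.inverse_mul_cancel _ h2]
    rfl
  refine (h.congr_of_eventuallyEq hev').congr_deriv ?_
  simp [hA0, hF0]
  rw [chartHessian_symm (0, v)]
  abel

end Bracket

/-! ### Horizontal curves with controlled speed -/

section Steerable
set_option linter.unusedSectionVars false

variable {E : Type*} [NormedAddCommGroup E] [NormedSpace ℝ E]
  {G : Type*} [TopologicalSpace G] [ChartedSpace E G] [Group G] [LieGroup 𝓘(ℝ, E) ∞ G]

/-- The velocity of a differentiable curve can be computed from a one-sided neighbourhood. -/
theorem HasVelocityAt.of_eqOn {γ β : ℝ → G} {v : GroupLieAlgebra 𝓘(ℝ, E) G} {s : ℝ} {S : Set ℝ}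
    (hβ : HasVelocityAt β v s) (hγ : MDifferentiableAt 𝓘(ℝ, ℝ) 𝓘(ℝ, E) γ s)
    (h : EqOn γ β S) (hs : s ∈ S) (hS : UniqueDiffWithinAt ℝ S s) : HasVelocityAt γ v s := by
  have h1 := hγ.hasMFDerivAt
  have h2 : HasMFDerivWithinAt 𝓘(ℝ, ℝ) 𝓘(ℝ, E) γ S s
      ((1 : ℝ →L[ℝ] ℝ).smulRight (mulInvariantVectorField v (β s) : E)) :=
    (HasMFDerivAt.hasMFDerivWithinAt hβ).congr_of_eventuallyEq
      (eventually_mem_nhdsWithin.mono h) (h hs)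
  have h3 : (mfderiv 𝓘(ℝ, ℝ) 𝓘(ℝ, E) γ s : ℝ →L[ℝ] E) =
      (1 : ℝ →L[ℝ] ℝ).smulRight (mulInvariantVectorField v (β s) : E) :=
    hS.uniqueMDiffWithinAt.eq h1.hasMFDerivWithinAt h2
  have key : ∀ k, k = γ s → (mfderiv 𝓘(ℝ, ℝ) 𝓘(ℝ, E) γ s : ℝ →L[ℝ] E) =
      (1 : ℝ →L[ℝ] ℝ).smulRight (mulInvariantVectorField v k : E) → HasVelocityAt γ v s := by
    rintro _ rfl h
    exact h1.congr_mfderiv h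
  exact key _ (h hs).symm h3

theorem HasVelocityAt.mfderiv_one {γ : ℝ → G} {v : GroupLieAlgebra 𝓘(ℝ, E) G} {s : ℝ}
    (h : HasVelocityAt γ v s) :
    mfderiv 𝓘(ℝ, ℝ) 𝓘(ℝ, E) γ s (1 : ℝ) = mulInvariantVectorField v (γ s) := by
  rw [HasMFDerivAt.mfderiv h]
  exact one_smul ℝ (mulInvariantVectorField v (γ s) : E)

theorem HasVelocityAt.congr_velocity {γ : ℝ → G} {v w : GroupLieAlgebra 𝓘(ℝ, E) G} {s : ℝ}
    (h : HasVelocityAt γ v s) (e : v = w) : HasVelocityAt γ w s := e ▸ h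

variable {V₁ : Submodule ℝ (GroupLieAlgebra 𝓘(ℝ, E) G)}

/-- The point `g` is the end point of a horizontal `C¹` curve that starts at `1` and has speed at
most `L`. The curve is defined on all of `ℝ` and rests outside `[0, 1]`, so that two such curves
can be concatenated without losing differentiability. -/
def IsSteerable (B : LinearMap.BilinForm ℝ V₁) (g : G) (L : ℝ) : Prop :=
  ∃ (γ : ℝ → G) (u : ℝ → V₁), ContMDiff 𝓘(ℝ, ℝ) 𝓘(ℝ, E) 1 γ ∧
  (∀ s, HasVelocityAt γ (u s : GroupLieAlgebra 𝓘(ℝ, E) G) s) ∧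
    (∀ s ≤ 0, γ s = 1 ∧ u s = 0) ∧ (∀ s ≥ 1, γ s = g ∧ u s = 0) ∧ ∀ s, Real.sqrt (B (u s) (u s)) ≤ L

theorem sqrt_smul (B : LinearMap.BilinForm ℝ V₁) (a : ℝ) (v : V₁) :
    Real.sqrt (B (a • v) (a • v)) = |a| * Real.sqrt (B v v) := by
  simp only [map_smul, LinearMap.smul_apply, smul_eq_mul]
  rw [← mul_assoc, Real.sqrt_mul (mul_self_nonneg a), Real.sqrt_mul_self_eq_abs]

variable {B : LinearMap.BilinForm ℝ V₁} {g h : G} {L L' : ℝ}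

theorem IsSteerable.mono (hg : IsSteerable B g L) (hL : L ≤ L') : IsSteerable B g L' := by
  obtain ⟨γ, u, h1, h2, h3, h4, h5⟩ := hg
  exact ⟨γ, u, h1, h2, h3, h4, fun s => (h5 s).trans hL⟩

theorem IsSteerable.inv (hg : IsSteerable B g L) : IsSteerable B g⁻¹ L := by
  obtain ⟨γ, u, h1, h2, h3, h4, h5⟩ := hg
  refine ⟨fun s => g⁻¹ * γ (1 - s), fun s => -u (1 - s), ?_, fun s => ?_, fun s hs => ?_,
      fun s hs => ?_, fun s => ?_⟩
  · exact contMDiff_const.mul (h1.comp (contDiff_const.sub contDiff_id).contMDiff)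
  · refine (HasVelocityAt.mul_left g⁻¹
      (HasVelocityAt.comp (h2 (1 - s)) ((hasDerivAt_id s).const_sub 1))).congr_velocity ?_
    simp
  · simp [h4 (1 - s) (by linarith)]
  · simp [h3 (1 - s) (by linarith)]
  · simpa using h5 (1 - s)

theorem IsSteerable.mul (hg : IsSteerable B g L) (hh : IsSteerable B h L) :
    IsSteerable B (g * h) (2 * L) := by
  obtain ⟨γ, u, h1, h2, h3, h4, h5⟩ := hg
  obtain ⟨γ', u', h1', h2', h3', h4', h5'⟩ := hh
  have d1 : ∀ s : ℝ, HasDerivAt (fun s : ℝ => 2 * s) 2 s := fun s => by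
    simpa using (hasDerivAt_id s).const_mul 2
  have d2 : ∀ s : ℝ, HasDerivAt (fun s : ℝ => 2 * s - 1) 2 s := fun s => (d1 s).sub_const 1
  have hc : ContMDiff 𝓘(ℝ, ℝ) 𝓘(ℝ, E) 1 fun s => γ (2 * s) * γ' (2 * s - 1) :=
    (h1.comp (contDiff_const.mul contDiff_id).contMDiff).mul
      (h1'.comp ((contDiff_const.mul contDiff_id).sub contDiff_const).contMDiff)
  refine ⟨_, fun s => (2 : ℝ) • u (2 * s) + (2 : ℝ) • u' (2 * s - 1), hc,
    fun s => ?_, fun s hs => ?_, fun s hs => ?_, fun s => ?_⟩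
  -- On each side of `s = 1 / 2` one of the two factors is constant.
  · rcases le_total s (1 / 2) with hs | hs
    · refine ((HasVelocityAt.comp (h2 (2 * s)) (d1 s)).of_eqOn (hc.mdifferentiable (by simp) s)
        (S := Iic (1 / 2)) ?_ hs
        (uniqueDiffOn_Iic _ s hs)).congr_velocity ?_
      · intro t ht
        simp only [mem_Iic] at ht
        simp [h3' (2 * t - 1) (by linarith)]
      · simp [h3' (2 * s - 1) (by linarith)]
    · refine ((HasVelocityAt.mul_left g (HasVelocityAt.comp (θ := fun s => 2 * s - 1)
        (h2' (2 * s - 1)) (d2 s))).of_eqOn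
        (hc.mdifferentiable (by simp) s) (S := Ici (1 / 2)) ?_ hs
        (uniqueDiffOn_Ici _ s hs)).congr_velocity ?_
      · intro t ht
        simp only [mem_Ici] at ht
        simp [h4 (2 * t) (by linarith)]
      · simp [h4 (2 * s) (by linarith)]
  · simp [h3 (2 * s) (by linarith), h3' (2 * s - 1) (by linarith)]
  · simp [h4 (2 * s) (by linarith), h4' (2 * s - 1) (by linarith)]
  · rcases le_total s (1 / 2) with hs | hs
    · simp only [(h3' (2 * s - 1) (by linarith)).2, smul_zero, add_zero, sqrt_smul, abs_two]
      linarith [h5 (2 * s)]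
    · simp only [(h4 (2 * s) (by linarith)).2, smul_zero, zero_add, sqrt_smul, abs_two]
      linarith [h5' (2 * s - 1)]

theorem IsSteerable.carnotEDist_le (hg : IsSteerable B g L) :
    carnotEDist B 1 g ≤ ENNReal.ofReal L := by
  obtain ⟨γ, u, h1, h2, h3, h4, h5⟩ := hg
  refine iInf_le_of_le γ (iInf_le_of_le u
      (iInf_le_of_le ⟨⟨⟨1, fun i => i, Nat.mono_cast, by simp, by simp,
    fun i _ => h1.contMDiffOn⟩, fun s _ _ => ?_⟩, (h3 0 le_rfl).1, (h4 1 le_rfl).1⟩ ?_))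
  · exact (h2 s).mfderiv_one
  · calc curveLength B u ≤ ∫⁻ s in Icc (0 : ℝ) 1, ENNReal.ofReal L :=
          lintegral_mono fun s => ENNReal.ofReal_le_ofReal (h5 s)
      _ = ENNReal.ofReal L := by simp

theorem deriv_smoothTransition_of_nonpos {s : ℝ} (hs : s ≤ 0) :
    deriv Real.smoothTransition s = 0 :=
  IsLocalMin.deriv_eq_zero <| Eventually.of_forall fun x => by
    rw [Real.smoothTransition.zero_of_nonpos hs]
    exact Real.smoothTransition.nonneg x

theorem deriv_smoothTransition_of_one_le {s : ℝ} (hs : 1 ≤ s) :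
    deriv Real.smoothTransition s = 0 :=
  IsLocalMax.deriv_eq_zero <| Eventually.of_forall fun x => by
    rw [Real.smoothTransition.one_of_one_le hs]
    exact Real.smoothTransition.le_one x

theorem exists_bound_deriv_smoothTransition :
    ∃ K, ∀ s, |deriv Real.smoothTransition s| ≤ K := by
  have hc : Continuous (deriv Real.smoothTransition) :=
    (Real.smoothTransition.contDiff (n := 1)).continuous_deriv le_rfl
  obtain ⟨K, hK⟩ := (isCompact_Icc (a := (0 : ℝ)) (b := 1)).exists_bound_of_continuousOn
    hc.continuousOn
  refine ⟨max K 0, fun s => ?_⟩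
  rcases le_total s 0 with h0 | h0
  · simp [deriv_smoothTransition_of_nonpos h0]
  rcases le_total 1 s with h1 | h1
  · simp [deriv_smoothTransition_of_one_le h1]
  exact (hK s ⟨h0, h1⟩).trans (le_max_left _ _)

/-- The one-parameter subgroup of a horizontal vector, run with a smooth step as time, is a curve as
in `IsSteerable`; the bound on its speed is uniform for `|t| ≤ 1`. -/
theorem isSteerable_lexp [T2Space G] [FiniteDimensional ℝ E] (B : LinearMap.BilinForm ℝ V₁)
    (v : V₁) : ∃ L, ∀ t : ℝ, |t| ≤ 1 →
      IsSteerable B (lexp (v : GroupLieAlgebra 𝓘(ℝ, E) G) t) L := by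
  obtain ⟨K, hK⟩ := exists_bound_deriv_smoothTransition
  refine ⟨K * Real.sqrt (B v v), fun t ht =>
    ⟨fun s => lexp (v : GroupLieAlgebra 𝓘(ℝ, E) G) (t * Real.smoothTransition s),
      fun s => (t * deriv Real.smoothTransition s) • v, ?_, fun s => ?_, fun s hs => ?_,
      fun s hs => ?_, fun s => ?_⟩⟩
  · exact (contMDiff_lexp _).comp
      (contDiff_const.mul Real.smoothTransition.contDiff).contMDiff
  · have hd : DifferentiableAt ℝ Real.smoothTransition s :=
      (Real.smoothTransition.contDiff (n := 1)).differentiable (by simp) s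
    exact HasVelocityAt.comp (θ := fun s => t * Real.smoothTransition s) (hasVelocityAt_lexp _ _)
      (hd.hasDerivAt.const_mul t)
  · simp [Real.smoothTransition.zero_of_nonpos hs, lexp_zero, deriv_smoothTransition_of_nonpos hs]
  · simp [Real.smoothTransition.one_of_one_le hs, deriv_smoothTransition_of_one_le hs]
  · rw [sqrt_smul, abs_mul]
    refine mul_le_mul_of_nonneg_right ?_ (Real.sqrt_nonneg _)
    exact (mul_le_of_le_one_left (abs_nonneg _) ht).trans (hK s)

end Steerable

/-! ### Accessibility by horizontal curves -/

section Chow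
set_option linter.unusedSectionVars false

variable {E : Type*} [NormedAddCommGroup E] [NormedSpace ℝ E] [FiniteDimensional ℝ E]
  {G : Type*} [TopologicalSpace G] [T2Space G] [ChartedSpace E G] [Group G] [LieGroup 𝓘(ℝ, E) ∞ G]

/-- The subgroup generated by the one-parameter subgroups of the vectors of `V₁`. -/
def horizontalSubgroup (V₁ : Submodule ℝ (GroupLieAlgebra 𝓘(ℝ, E) G)) : Subgroup G :=
  Subgroup.closure {g | ∃ v ∈ V₁, ∃ t : ℝ, lexp v t = g}

variable {V₁ : Submodule ℝ (GroupLieAlgebra 𝓘(ℝ, E) G)}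

theorem lexp_mem_horizontalSubgroup {v : GroupLieAlgebra 𝓘(ℝ, E) G} (hv : v ∈ V₁) (t : ℝ) :
    lexp v t ∈ horizontalSubgroup V₁ := Subgroup.subset_closure ⟨v, hv, t, rfl⟩

theorem exists_isSteerable (B : LinearMap.BilinForm ℝ V₁) {g : G}
    (hg : g ∈ horizontalSubgroup V₁) : ∃ L, IsSteerable B g L := by
  induction hg using Subgroup.closure_induction with
  | mem g hg =>
    obtain ⟨v, hv, t, rfl⟩ := hg
    obtain ⟨L, hL⟩ := isSteerable_lexp B (t • ⟨v, hv⟩)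
    have := hL 1 (by simp)
    rw [Submodule.coe_smul, lexp_smul, mul_one] at this
    exact ⟨L, this⟩
  | one =>
    obtain ⟨L, hL⟩ := isSteerable_lexp B 0
    have := hL 0 (by simp)
    rw [lexp_zero] at this
    exact ⟨L, this⟩
  | mul g h _ _ ihg ihh =>
    obtain ⟨L, hL⟩ := ihg
    obtain ⟨L', hL'⟩ := ihh
    exact ⟨_, (hL.mono (le_max_left L L')).mul (hL'.mono (le_max_right L L'))⟩
  | inv g _ ih =>
    obtain ⟨L, hL⟩ := ih
    exact ⟨L, hL.inv⟩

/-- The span of the vectors `Ad h v`, for `h` in the horizontal subgroup and `v ∈ V₁`. These are the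
directions of motion along the curves `t ↦ h exp (t v) h⁻¹` of the horizontal subgroup. -/
def adjointSpan (V₁ : Submodule ℝ (GroupLieAlgebra 𝓘(ℝ, E) G)) : Submodule ℝ E :=
  Submodule.span ℝ {w | ∃ h ∈ horizontalSubgroup V₁, ∃ v ∈ V₁, Ad E h v = w}

theorem Ad_mem_adjointSpan {g : G} (hg : g ∈ horizontalSubgroup V₁) {w : E}
    (hw : w ∈ adjointSpan V₁) : Ad E g w ∈ adjointSpan V₁ := by
  induction hw using Submodule.span_induction with
  | mem w hw =>
    obtain ⟨h, hh, v, hv, rfl⟩ := hw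
    exact Submodule.subset_span ⟨g * h, mul_mem hg hh, v, hv, by rw [Ad_mul]; rfl⟩
  | zero => simp
  | add x y _ _ hx hy => rw [map_add]; exact add_mem hx hy
  | smul a x _ hx => rw [map_smul]; exact Submodule.smul_mem _ _ hx

theorem HasVelocityAt.hasDerivAt_chart {γ : ℝ → G} {v : GroupLieAlgebra 𝓘(ℝ, E) G} {s : ℝ}
    (h : HasVelocityAt γ v s) (h0 : γ s = 1) : HasDerivAt (fun t => chart E G (γ t)) v s := by
  have h1 := ((contMDiffAt_chart (E := E) (G := G) (g := γ s)
    (by rw [h0]; exact one_mem_chart_source)).mdifferentiableAt (by simp)).hasMFDerivAt.comp s h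
  have key : ∀ k : G, k = 1 → (mfderiv 𝓘(ℝ, E) 𝓘(ℝ, E) (chart E G) k : E →L[ℝ] E)
      (mulInvariantVectorField v k) = v := by
    rintro _ rfl
    rw [mfderiv_chart_one, mulInvariantVectorField_one]
    rfl
  have h2 : HasFDerivAt (fun t => chart E G (γ t))
      ((mfderiv 𝓘(ℝ, E) 𝓘(ℝ, E) (chart E G) (γ s) : E →L[ℝ] E).comp
        ((1 : ℝ →L[ℝ] ℝ).smulRight (mulInvariantVectorField v (γ s) : E))) s := h1.hasFDerivAt
  refine hasDerivAt_iff_hasFDerivAt.2 (h2.congr_fderiv (ContinuousLinearMap.ext fun r => ?_))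
  refine Eq.trans ?_ (congrArg (fun x : E => r • x) (key _ h0))
  exact (mfderiv 𝓘(ℝ, E) 𝓘(ℝ, E) (chart E G) (γ s) : E →L[ℝ] E).map_smul r
    (mulInvariantVectorField v (γ s))

/-- The span is invariant under `Ad (exp (t x))` for `x ∈ V₁` and closed, so it contains the
derivative at `t = 0`, which is the bracket with `x`. -/
theorem bracket_mem_adjointSpan {x : GroupLieAlgebra 𝓘(ℝ, E) G} (hx : x ∈ V₁)
    {y : GroupLieAlgebra 𝓘(ℝ, E) G}
    (hy : (y : E) ∈ adjointSpan V₁) :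
    ((⁅x, y⁆ : GroupLieAlgebra 𝓘(ℝ, E) G) : E) ∈ adjointSpan V₁ := by
  have hd := hasDerivAt_Ad (lexp_zero x) ((hasVelocityAt_lexp x 0).hasDerivAt_chart (lexp_zero x))
    (hasVelocityAt_lexp x 0).continuousAt y
  have hb := bracket_eq_chartHessian x y
  have : ∀ z : E, HasDerivAt (fun t => Ad E (lexp x t) y) z 0 → z ∈ adjointSpan V₁ := by
    intro z hz
    refine (Submodule.closed_of_finiteDimensional (adjointSpan V₁)).mem_of_tendsto hz.tendsto_slope
      (Eventually.of_forall fun t => ?_)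
    exact Submodule.smul_mem _ _ (sub_mem (Ad_mem_adjointSpan (lexp_mem_horizontalSubgroup hx t) hy)
      (Ad_mem_adjointSpan (lexp_mem_horizontalSubgroup hx 0) hy))
  exact this _ (hd.congr_deriv hb.symm)

theorem adjointSpan_eq_top {V : ℕ → Submodule ℝ (GroupLieAlgebra 𝓘(ℝ, E) G)}
    (hV : IsStratification V) : adjointSpan (V 1) = ⊤ := by
  have h : ∀ j, ∀ x ∈ V j, (x : E) ∈ adjointSpan (V 1) := by
    intro j
    induction j with
    | zero =>
      intro x hx
      rw [hV.layer_zero, Submodule.mem_bot] at hx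
      rw [hx]
      exact zero_mem (adjointSpan (V 1))
    | succ j ih =>
      intro x hx
      rcases Nat.eq_zero_or_pos j with rfl | hj
      · exact Submodule.subset_span ⟨1, one_mem _, x, hx, by rw [Ad_one]; rfl⟩
      · rw [← hV.bracket_eq j hj] at hx
        induction hx using Submodule.span_induction with
        | mem x hx =>
          obtain ⟨a, ha, b, hb, rfl⟩ := hx
          exact bracket_mem_adjointSpan ha (ih b hb)
        | zero => exact zero_mem (adjointSpan (V 1))
        | add x y _ _ hx hy => exact add_mem (S := Submodule ℝ E) hx hy
        | smul a x _ hx => exact Submodule.smul_mem (M := E) _ a hx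
  rw [eq_top_iff]
  rintro (x : E) -
  have hx : (x : GroupLieAlgebra 𝓘(ℝ, E) G) ∈ ⨆ j, V j := by
    rw [hV.isInternal.submodule_iSup_eq_top]; trivial
  induction hx using Submodule.iSup_induction' with
  | mem j x hx => exact h j x hx
  | zero => exact zero_mem (adjointSpan (V 1))
  | add x y _ _ hx hy => exact add_mem (S := Submodule ℝ E) hx hy

theorem hasDerivAt_chart_conj_lexp (h : G) (v : GroupLieAlgebra 𝓘(ℝ, E) G) :
    HasDerivAt (fun t => chart E G (h * lexp v t * h⁻¹)) (Ad E h v) 0 := by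
  have h1 := (hasVelocityAt_lexp v 0).hasDerivAt_chart (lexp_zero v)
  have h2 : HasFDerivAt (chartConj (E := E) h) (Ad E h) (chart E G (lexp v 0)) := by
    rw [lexp_zero, chart_one]
    exact hasFDerivAt_chartConj h
  refine (h2.comp_hasDerivAt 0 h1).congr_of_eventuallyEq ?_
  have hs : ∀ᶠ t in 𝓝 0, lexp v t ∈ (chart E G).source :=
    (hasVelocityAt_lexp v 0).continuousAt (by rw [lexp_zero]; exact chart_source_mem_nhds)
  filter_upwards [hs] with t ht
  simp [chartConj, (chart E G).left_inv ht]

theorem contDiffAt_chart_comp {F : Type*} [NormedAddCommGroup F] [NormedSpace ℝ F] {Φ : F → G}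
    (h : ContMDiff 𝓘(ℝ, F) 𝓘(ℝ, E) 1 Φ) {x : F} (hx : Φ x = 1) :
    ContDiffAt ℝ 1 (fun y => chart E G (Φ y)) x := by
  rw [← contMDiffAt_iff_contDiffAt]
  have h1 : ContMDiffAt 𝓘(ℝ, E) 𝓘(ℝ, E) 1 (chart E G) (Φ x) :=
    (contMDiffAt_chart (by rw [hx]; exact one_mem_chart_source)).of_le ENat.LEInfty.out
  exact h1.comp x h.contMDiffAt

/-- Given finitely many vectors `Ad h v`, the product of the curves `t ↦ h exp (t v) h⁻¹`, one real
parameter for each, is a `C¹` map with values in the horizontal subgroup whose differential at `0`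
has all the given vectors in its range. Its values near `0` are reached with bounded speed. -/
theorem exists_map_range_fderiv (B : LinearMap.BilinForm ℝ V₁) (T : Finset E)
    (hT : (T : Set E) ⊆ {w | ∃ h ∈ horizontalSubgroup V₁, ∃ v ∈ V₁, Ad E h v = w}) :
    ∃ (F : Type) (_ : NormedAddCommGroup F) (_ : NormedSpace ℝ F) (_ : FiniteDimensional ℝ F)
      (Φ : F → G) (L : ℝ), Φ 0 = 1 ∧ ContMDiff 𝓘(ℝ, F) 𝓘(ℝ, E) 1 Φ ∧
      (∀ w ∈ T, ∃ x, fderiv ℝ (fun y => chart E G (Φ y)) 0 x = w) ∧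
      (∀ x, Φ x ∈ horizontalSubgroup V₁) ∧ ∀ᶠ x in 𝓝 0, IsSteerable B (Φ x) L := by
  classical
  induction T using Finset.induction_on with
  | empty =>
    obtain ⟨L, hL⟩ := exists_isSteerable B (one_mem (horizontalSubgroup V₁))
    exact ⟨ℝ, inferInstance, inferInstance, inferInstance, fun _ => 1, L, rfl, contMDiff_const,
      by simp, fun _ => one_mem _, Eventually.of_forall fun _ => hL⟩
  | insert w T hw ih =>
    rw [Finset.coe_insert, insert_subset_iff] at hT
    obtain ⟨F, _, _, _, Φ, L, h0, hc, hr, hm, hL⟩ := ih hT.2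
    obtain ⟨h, hh, v, hv, rfl⟩ := hT.1
    obtain ⟨L₁, hL₁⟩ := exists_isSteerable B hh
    obtain ⟨L₂, hL₂⟩ := isSteerable_lexp B ⟨v, hv⟩
    set Ψ : F × ℝ → G := fun p => Φ p.1 * (h * lexp v p.2 * h⁻¹) with hΨ
    have hΨc : ContMDiff 𝓘(ℝ, F × ℝ) 𝓘(ℝ, E) 1 Ψ :=
      (hc.comp contDiff_fst.contMDiff).mul
        ((contMDiff_const.mul ((contMDiff_lexp v).comp contDiff_snd.contMDiff)).mul contMDiff_const)
    have hΨ0 : Ψ 0 = 1 := by simp [hΨ, h0, lexp_zero]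
    have hd : HasFDerivAt (fun y => chart E G (Ψ y)) (fderiv ℝ (fun y => chart E G (Ψ y)) 0)
        (0, 0) :=
      ((contDiffAt_chart_comp hΨc hΨ0).differentiableAt (by simp)).hasFDerivAt
    have hst : ∃ M, ∀ᶠ p in 𝓝 0, IsSteerable B (Ψ p) M := by
      have e1 : ∀ᶠ p : F × ℝ in 𝓝 0, IsSteerable B (Φ p.1) L :=
        (continuous_fst.continuousAt (x := (0 : F × ℝ))).eventually hL
      have e2 : ∀ᶠ p : F × ℝ in 𝓝 0, |p.2| < 1 :=
        (continuous_snd.abs.continuousAt (x := (0 : F × ℝ))).eventually (gt_mem_nhds (by simp))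
      refine ⟨2 * max L (2 * max (2 * max L₁ L₂) L₁), ?_⟩
      filter_upwards [e1, e2] with p h1 h2
      have h3 := ((hL₁.mono (le_max_left L₁ L₂)).mul ((hL₂ _ h2.le).mono (le_max_right L₁ L₂)))
      have h4 := (h3.mono (le_max_left _ L₁)).mul (hL₁.inv.mono (le_max_right _ L₁))
      exact (h1.mono (le_max_left L _)).mul (h4.mono (le_max_right L _))
    obtain ⟨M, hM⟩ := hst
    refine ⟨F × ℝ, inferInstance, inferInstance, inferInstance, Ψ, M, hΨ0, hΨc, ?_, ?_, hM⟩
    · rw [Finset.forall_mem_insert]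
      constructor
      · refine ⟨(0, 1), ?_⟩
        have h1 : HasDerivAt (fun t : ℝ => ((0 : F), t)) (0, 1) 0 :=
          (hasDerivAt_const _ _).prodMk (hasDerivAt_id _)
        have h2 := HasFDerivAt.comp_hasDerivAt (f := fun t : ℝ => ((0 : F), t)) 0 hd h1
        refine h2.unique ?_
        convert! hasDerivAt_chart_conj_lexp h v using 2 with t
        simp [hΨ, h0]
      · intro w hw
        obtain ⟨x, rfl⟩ := hr w hw
        refine ⟨(x, 0), ?_⟩
        have h2 := HasFDerivAt.comp (f := fun x : F => (x, (0 : ℝ))) 0 hd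
            (hasFDerivAt_prodMk_left _ _)
        have h3 : (fun y => chart E G (Ψ y)) ∘ (fun x : F => (x, (0 : ℝ))) =
            fun y => chart E G (Φ y) := by
          ext y
          simp [hΨ, lexp_zero]
        rw [h3] at h2
        rw [h2.fderiv]
        simp
    · exact fun x => mul_mem (hm _) (mul_mem (mul_mem hh (lexp_mem_horizontalSubgroup hv _))
        (inv_mem hh))

/-- A neighbourhood of the identity is reached by horizontal curves of bounded speed: the map of
`exists_map_range_fderiv` for a spanning family is a submersion at `0`, hence open there. -/
theorem exists_eventually_isSteerable {V : ℕ → Submodule ℝ (GroupLieAlgebra 𝓘(ℝ, E) G)}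
    (hV : IsStratification V) (B : LinearMap.BilinForm ℝ (V 1)) :
    ∃ L, ∀ᶠ g in 𝓝 (1 : G), g ∈ horizontalSubgroup (V 1) ∧ IsSteerable B g L := by
  obtain ⟨T, hT, hspan⟩ := Submodule.fg_span_iff_fg_span_finset_subset (R := ℝ)
    {w : E | ∃ h ∈ horizontalSubgroup (V 1), ∃ v ∈ V 1, Ad E h v = w} |>.1
    (IsNoetherian.noetherian _)
  obtain ⟨F, _, _, _, Φ, L, h0, hc, hr, hm, hL⟩ := exists_map_range_fderiv B T hT
  have hd := (contDiffAt_chart_comp hc h0).hasStrictFDerivAt (by simp)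
  have hsurj : (fderiv ℝ (fun y => chart E G (Φ y)) 0).range = ⊤ := by
    rw [eq_top_iff, ← adjointSpan_eq_top hV, adjointSpan, hspan, Submodule.span_le]
    intro w hw
    obtain ⟨x, rfl⟩ := hr w hw
    exact ⟨x, rfl⟩
  have hmap := hd.map_nhds_eq_of_surj hsurj
  rw [h0, chart_one] at hmap
  have hs : ∀ᶠ x in 𝓝 0, Φ x ∈ (chart E G).source :=
    hc.continuous.continuousAt.eventually (by rw [h0]; exact chart_source_mem_nhds)
  have him := image_mem_map (m := fun y => chart E G (Φ y)) (hL.and hs)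
  rw [hmap] at him
  have hcont : ContinuousAt (chart E G) 1 := (contMDiffAt_chart one_mem_chart_source).continuousAt
  refine ⟨L, ?_⟩
  filter_upwards [hcont him, chart_source_mem_nhds (E := E)] with g ⟨x, ⟨hx1, hx2⟩, hx⟩ hg
  rw [← (chart E G).injOn hx2 hg hx]
  exact ⟨hm x, hx1⟩

theorem horizontalSubgroup_eq_top [PreconnectedSpace G]
    {V : ℕ → Submodule ℝ (GroupLieAlgebra 𝓘(ℝ, E) G)}
    (hV : IsStratification V) : horizontalSubgroup (V 1) = ⊤ := by
  have ht : IsTopologicalGroup G := topologicalGroup_of_lieGroup 𝓘(ℝ, E) ∞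
  obtain ⟨L, hL⟩ := exists_eventually_isSteerable hV 0
  have ho := (horizontalSubgroup (V 1)).isOpen_of_mem_nhds (hL.mono fun _ h => h.1)
  have := IsClopen.eq_univ ⟨Subgroup.isClosed_of_isOpen _ ho, ho⟩ ⟨1, one_mem _⟩
  exact SetLike.coe_injective this

end Chow

/-! ### The Carnot distance -/

section Distance
set_option linter.unusedSectionVars false

/-- A linear form is bounded with respect to a scalar product: it is represented by a vector, and
the Cauchy–Schwarz inequality applies. -/
theorem exists_abs_le_mul_sqrt {W : Type*} [AddCommGroup W] [Module ℝ W] [FiniteDimensional ℝ W]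
    (B : LinearMap.BilinForm ℝ W) (hB_symm : ∀ v w, B v w = B w v)
    (hB_pos : ∀ v, v ≠ 0 → 0 < B v v) (ℓ : W →ₗ[ℝ] ℝ) :
    ∃ K, ∀ v, |ℓ v| ≤ K * Real.sqrt (B v v) := by
  have hnn : ∀ v, 0 ≤ B v v := fun v => by
    rcases eq_or_ne v 0 with rfl | hv
    · simp
    · exact (hB_pos v hv).le
  have hinj : Function.Injective B := by
    rw [← LinearMap.ker_eq_bot, LinearMap.ker_eq_bot']
    intro v hv
    by_contra h
    have := hB_pos v h
    rw [hv] at this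
    simp at this
  obtain ⟨a, rfl⟩ := (LinearMap.injective_iff_surjective_of_finrank_eq_finrank
    (Subspace.dual_finrank_eq (K := ℝ) (V := W)).symm).1 hinj ℓ
  refine ⟨Real.sqrt (B a a), fun v => ?_⟩
  rw [← Real.sqrt_mul (hnn a), ← Real.sqrt_sq_eq_abs]
  apply Real.sqrt_le_sqrt
  have := LinearMap.BilinForm.apply_mul_apply_le_of_forall_zero_le B hnn a v
  rwa [hB_symm v a, ← sq] at this

variable {E : Type*} [NormedAddCommGroup E] [NormedSpace ℝ E]
  {G : Type*} [TopologicalSpace G] [ChartedSpace E G] [Group G] [LieGroup 𝓘(ℝ, E) ∞ G]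

/-- The derivative of the function `f` along the left-invariant vector field `v`. -/
noncomputable def lieDeriv (f : G → ℝ) (v : GroupLieAlgebra 𝓘(ℝ, E) G) (g : G) : ℝ :=
  mfderiv 𝓘(ℝ, E) 𝓘(ℝ, ℝ) f g (mulInvariantVectorField v g)

theorem HasVelocityAt.hasDerivAt_comp {f : G → ℝ} {γ : ℝ → G} {v : GroupLieAlgebra 𝓘(ℝ, E) G}
    {s : ℝ}
    (h : HasVelocityAt γ v s) (hf : MDifferentiableAt 𝓘(ℝ, E) 𝓘(ℝ, ℝ) f (γ s)) :
    HasDerivAt (fun s => f (γ s)) (lieDeriv f v (γ s)) s := by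
  have h2 : HasFDerivAt (fun s => f (γ s))
      ((mfderiv 𝓘(ℝ, E) 𝓘(ℝ, ℝ) f (γ s) : E →L[ℝ] ℝ).comp
        ((1 : ℝ →L[ℝ] ℝ).smulRight (mulInvariantVectorField v (γ s) : E))) s :=
    (hf.hasMFDerivAt.comp s h).hasFDerivAt
  refine hasDerivAt_iff_hasFDerivAt.2 (h2.congr_fderiv (ContinuousLinearMap.ext fun r => ?_))
  exact (mfderiv 𝓘(ℝ, E) 𝓘(ℝ, ℝ) f (γ s) : E →L[ℝ] ℝ).map_smul r
    (mulInvariantVectorField v (γ s))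

theorem continuous_lieDeriv {f : G → ℝ} (hf : ContMDiff 𝓘(ℝ, E) 𝓘(ℝ, ℝ) ∞ f)
    (v : GroupLieAlgebra 𝓘(ℝ, E) G) :
    Continuous (lieDeriv f v) := by
  have h1 := hf.continuous_tangentMap (by simp)
  have h2 := h1.comp (contMDiff_one_mulInvariantVectorField v).continuous
  exact (contMDiff_snd_tangentBundle_modelSpace ℝ 𝓘(ℝ, ℝ) (n := ∞)).continuous.comp h2

theorem exists_bound_lieDeriv [FiniteDimensional ℝ E] {V₁ : Submodule ℝ (GroupLieAlgebra 𝓘(ℝ, E) G)}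
    (B : LinearMap.BilinForm ℝ V₁)
    (hB_symm : ∀ v w, B v w = B w v) (hB_pos : ∀ v, v ≠ 0 → 0 < B v v)
    {f : G → ℝ} (hf : ContMDiff 𝓘(ℝ, E) 𝓘(ℝ, ℝ) ∞ f) (hc : HasCompactSupport f) :
    ∃ M : ℝ, 0 ≤ M ∧ ∀ (v : V₁) (g : G),
      |lieDeriv f (v : GroupLieAlgebra 𝓘(ℝ, E) G) g| ≤ M * Real.sqrt (B v v) := by
  have : FiniteDimensional ℝ (GroupLieAlgebra 𝓘(ℝ, E) G) := inferInstanceAs (FiniteDimensional ℝ E)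
  let T : G → V₁ →ₗ[ℝ] ℝ := fun g =>
    { toFun := fun v => lieDeriv f (v : GroupLieAlgebra 𝓘(ℝ, E) G) g
      map_add' := fun v w => by
        rw [Submodule.coe_add, lieDeriv, mulInvariantVectorField_add]
        exact (mfderiv 𝓘(ℝ, E) 𝓘(ℝ, ℝ) f g).map_add _ _
      map_smul' := fun a v => by
        rw [Submodule.coe_smul, lieDeriv, mulInvariantVectorField_smul]
        exact (mfderiv 𝓘(ℝ, E) 𝓘(ℝ, ℝ) f g).map_smul _ _ }
  have hT : ∀ v : V₁, ∃ C, ∀ g, ‖T g v‖ ≤ C := by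
    intro v
    refine (continuous_lieDeriv hf v).bounded_above_of_compact_support ?_
    refine hc.mono' fun g hg => ?_
    by_contra h
    apply hg
    have : f =ᶠ[𝓝 g] fun _ => 0 := notMem_tsupport_iff_eventuallyEq.1 h
    have e := this.mfderiv_eq (I := 𝓘(ℝ, E)) (I' := 𝓘(ℝ, ℝ))
    rw [mfderiv_const] at e
    exact congrArg (fun A : E →L[ℝ] ℝ =>
        A (mulInvariantVectorField (v : GroupLieAlgebra 𝓘(ℝ, E) G) g)) e
  choose C hC using hT
  let b := Module.finBasis ℝ V₁
  choose K hK using fun i => exists_abs_le_mul_sqrt B hB_symm hB_pos (b.coord i)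
  refine ⟨∑ i, |K i| * |C (b i)|, by positivity, fun v g => ?_⟩
  change |T g v| ≤ _
  have : T g v = ∑ i, b.coord i v * T g (b i) := by
    conv_lhs => rw [← b.sum_repr v, map_sum]
    simp only [map_smul, smul_eq_mul, b.coord_apply]
  rw [this, Finset.sum_mul]
  refine (Finset.abs_sum_le_sum_abs _ _).trans (Finset.sum_le_sum fun i _ => ?_)
  rw [abs_mul]
  have h1 := (hK i v).trans (mul_le_mul_of_nonneg_right (le_abs_self (K i)) (Real.sqrt_nonneg _))
  have h2 := (hC (b i) g).trans (le_abs_self _)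
  rw [Real.norm_eq_abs] at h2
  calc _ ≤ (|K i| * Real.sqrt (B v v)) * |C (b i)| := by gcongr
    _ = _ := by ring

variable {V₁ : Submodule ℝ (GroupLieAlgebra 𝓘(ℝ, E) G)}

theorem IsHorizontalCurve.hasVelocityAt {γ : ℝ → G} {u : ℝ → V₁} (h : IsHorizontalCurve V₁ γ u)
    {s : ℝ} (hs : s ∈ Ioo (0 : ℝ) 1)
    (hd : MDifferentiableAt 𝓘(ℝ, ℝ) 𝓘(ℝ, E) γ s) :
    HasVelocityAt γ (u s : GroupLieAlgebra 𝓘(ℝ, E) G) s := by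
  refine hd.hasMFDerivAt.congr_mfderiv (ContinuousLinearMap.ext fun r : ℝ => ?_)
  have e := h.velocity s hs hd
  have key : ∀ A : ℝ →L[ℝ] E, A r = r • A 1 := fun A => by
    rw [← ContinuousLinearMap.map_smul, smul_eq_mul, mul_one]
  exact (key (mfderiv 𝓘(ℝ, ℝ) 𝓘(ℝ, E) γ s)).trans (congrArg (fun x : E => r • x) e)

/-- A function with bounded horizontal derivative is Lipschitz along horizontal curves. -/
theorem IsHorizontalCurve.enorm_sub_le {B : LinearMap.BilinForm ℝ V₁} {f : G → ℝ}
    (hf : ContMDiff 𝓘(ℝ, E) 𝓘(ℝ, ℝ) ∞ f) {M : ℝ} (hM : 0 ≤ M)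
    (hfM : ∀ (v : V₁) (g : G),
      |lieDeriv f (v : GroupLieAlgebra 𝓘(ℝ, E) G) g| ≤ M * Real.sqrt (B v v))
    {γ : ℝ → G} {u : ℝ → V₁} (h : IsHorizontalCurve V₁ γ u) :
    ‖f (γ 1) - f (γ 0)‖ₑ ≤ ENNReal.ofReal M * curveLength B u := by
  obtain ⟨n, τ, hτ, h0, h1, hC⟩ := h.piecewise_C1
  have key : ∀ k ≤ n, ‖f (γ (τ k)) - f (γ (τ 0))‖ₑ ≤
      ∫⁻ s in Ioc (τ 0) (τ k), ENNReal.ofReal M * ENNReal.ofReal (Real.sqrt (B (u s) (u s))) := by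
    intro k
    induction k with
    | zero => simp
    | succ k ih =>
      intro hk
      have hle : τ k ≤ τ (k + 1) := hτ k.le_succ
      have hunion : Ioc (τ 0) (τ (k + 1)) = Ioc (τ 0) (τ k) ∪ Ioc (τ k) (τ (k + 1)) :=
        (Ioc_union_Ioc_eq_Ioc (hτ k.zero_le) hle).symm
      rw [hunion, lintegral_union measurableSet_Ioc (Ioc_disjoint_Ioc_of_le le_rfl)]
      have hC1 : ContDiffOn ℝ 1 (fun s => f (γ s)) (Icc (τ k) (τ (k + 1))) := by
        rw [← contMDiffOn_iff_contDiffOn]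
        exact (hf.of_le ENat.LEInfty.out).comp_contMDiffOn (hC k (by omega))
      have hstep : ‖f (γ (τ (k + 1))) - f (γ (τ k))‖ₑ ≤
          ∫⁻ s in Ioc (τ k) (τ (k + 1)),
            ENNReal.ofReal M * ENNReal.ofReal (Real.sqrt (B (u s) (u s))) := by
        refine (enorm_sub_le_lintegral_deriv_of_contDiffOn_Icc hC1 hle).trans ?_
        rw [← restrict_Ioo_eq_restrict_Icc, ← restrict_Ioo_eq_restrict_Ioc]
        refine setLIntegral_mono' measurableSet_Ioo fun s hs => ?_
        have hs01 : s ∈ Ioo (0 : ℝ) 1 :=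
            ⟨h0 ▸ (hτ k.zero_le).trans_lt hs.1, h1 ▸ hs.2.trans_le (hτ hk)⟩
        have hd : MDifferentiableAt 𝓘(ℝ, ℝ) 𝓘(ℝ, E) γ s :=
          ((hC k (by omega)).contMDiffAt (Icc_mem_nhds hs.1 hs.2)).mdifferentiableAt (by simp)
        have hv := h.hasVelocityAt hs01 hd
        rw [(hv.hasDerivAt_comp (hf.mdifferentiable (by simp) (γ s))).deriv,
          ← ENNReal.ofReal_mul hM, Real.enorm_eq_ofReal_abs]
        exact ENNReal.ofReal_le_ofReal (hfM _ _)
      calc ‖f (γ (τ (k + 1))) - f (γ (τ 0))‖ₑ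
          = ‖(f (γ (τ k)) - f (γ (τ 0))) + (f (γ (τ (k + 1))) - f (γ (τ k)))‖ₑ := by congr 1; ring
        _ ≤ _ := (enorm_add_le _ _).trans (add_le_add (ih (by omega)) hstep)
  have := key n le_rfl
  rw [h0, h1] at this
  refine this.trans ?_
  rw [lintegral_const_mul' _ _ ENNReal.ofReal_ne_top, curveLength]
  gcongr
  exact Ioc_subset_Icc_self

theorem le_carnotEDist_iff {B : LinearMap.BilinForm ℝ V₁} {p q : G} {a : ℝ≥0∞} :
    a ≤ carnotEDist B p q ↔ ∀ (γ : ℝ → G) (u : ℝ → V₁),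
      IsHorizontalCurve V₁ γ u → γ 0 = p → γ 1 = q →
      a ≤ curveLength B u := by
  simp only [carnotEDist, le_iInf_iff]
  exact ⟨fun h γ u h1 h2 h3 => h γ u ⟨h1, h2, h3⟩, fun h γ u h1 => h γ u h1.1 h1.2.1 h1.2.2⟩

theorem carnotEDist_le {B : LinearMap.BilinForm ℝ V₁} {γ : ℝ → G} {u : ℝ → V₁} {p q : G}
    (h : IsHorizontalCurve V₁ γ u) (h0 : γ 0 = p) (h1 : γ 1 = q) :
    carnotEDist B p q ≤ curveLength B u :=
  le_carnotEDist_iff.1 le_rfl γ u h h0 h1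

/-- The Carnot distance separates the identity from the complement of any neighbourhood `U`: a bump
function supported in `U` has bounded horizontal derivative, hence is Lipschitz for the Carnot
distance, and it has to drop from `1` to `0` along a curve that leaves `U`. -/
theorem exists_carnotBall_subset [FiniteDimensional ℝ E] [T2Space G] (B : LinearMap.BilinForm ℝ V₁)
    (hB_symm : ∀ v w, B v w = B w v) (hB_pos : ∀ v, v ≠ 0 → 0 < B v v) {U : Set G}
    (hU : U ∈ 𝓝 (1 : G)) :
    ∃ ε > 0, carnotBall B 1 ε ⊆ U := by
  have : IsManifold 𝓘(ℝ, E) ∞ G := inferInstance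
  obtain ⟨f, -, hfU⟩ :=
    (SmoothBumpFunction.nhds_basis_tsupport (I := 𝓘(ℝ, E)) (1 : G)).mem_iff.1 hU
  obtain ⟨M, hM, hfM⟩ := exists_bound_lieDeriv B hB_symm hB_pos f.contMDiff f.hasCompactSupport
  refine ⟨1 / (M + 1), by positivity, fun g hg => ?_⟩
  by_contra hgU
  have hg0 : f g = 0 := by
    by_contra h
    exact hgU (hfU (subset_tsupport f h))
  have h1 : ENNReal.ofReal (1 / (M + 1)) ≤ carnotEDist B 1 g := by
    rw [le_carnotEDist_iff]
    intro γ u hγ hγ0 hγ1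
    have h2 := hγ.enorm_sub_le f.contMDiff hM hfM
    rw [hγ0, hγ1, hg0, f.eq_one] at h2
    have h3 : (1 : ℝ≥0∞) ≤ ENNReal.ofReal (M + 1) * curveLength B u := by
      calc (1 : ℝ≥0∞) = ‖(0 : ℝ) - 1‖ₑ := by simp
        _ ≤ _ := h2.trans (by gcongr; linarith)
    rw [one_div, ENNReal.ofReal_inv_of_pos (by linarith)]
    have h0 : ENNReal.ofReal (M + 1) ≠ 0 := by simpa using by linarith
    exact (ENNReal.inv_le_iff_le_mul (fun _ => h0)
      (fun h => absurd h ENNReal.ofReal_ne_top)).2 h3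
  exact absurd hg (not_lt.2 h1)

theorem IsHorizontalCurve.mul_left {γ : ℝ → G} {u : ℝ → V₁} (h : IsHorizontalCurve V₁ γ u) (g : G) :
    IsHorizontalCurve V₁ (fun s => g * γ s) u := by
  obtain ⟨n, τ, hτ, h0, h1, hC⟩ := h.piecewise_C1
  refine ⟨⟨n, τ, hτ, h0, h1, fun i hi => contMDiffOn_const.mul (hC i hi)⟩, fun s hs hd => ?_⟩
  have hd' : MDifferentiableAt 𝓘(ℝ, ℝ) 𝓘(ℝ, E) γ s := by
    have := ((contMDiff_mul_left (I := 𝓘(ℝ, E)) (n := ∞) (a := g⁻¹)).mdifferentiable (by simp)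
        (g * γ s)).comp s hd
    simpa [Function.comp_def] using this
  exact (HasVelocityAt.mul_left g (h.hasVelocityAt hs hd')).mfderiv_one

theorem carnotEDist_mul_left (B : LinearMap.BilinForm ℝ V₁) (g p q : G) :
    carnotEDist B (g * p) (g * q) = carnotEDist B p q := by
  have key : ∀ g p q : G, carnotEDist B (g * p) (g * q) ≤ carnotEDist B p q := by
    intro g p q
    rw [le_carnotEDist_iff]
    rintro γ u h rfl rfl
    exact carnotEDist_le (h.mul_left g) rfl rfl
  refine le_antisymm (key g p q) ?_
  simpa using key g⁻¹ (g * p) (g * q)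

theorem IsHorizontalCurve.map_dilation {γ : ℝ → G} {u : ℝ → V₁} (h : IsHorizontalCurve V₁ γ u)
    {t : ℝ} {δ : G ≃* G}
    (hδ : IsDilation V₁ t δ) : IsHorizontalCurve V₁ (fun s => δ (γ s)) (fun s => t • u s) := by
  obtain ⟨n, τ, hτ, h0, h1, hC⟩ := h.piecewise_C1
  refine ⟨⟨n, τ, hτ, h0, h1, fun i hi => (hδ.smooth.of_le ENat.LEInfty.out).comp_contMDiffOn
      (hC i hi)⟩, fun s hs hd => ?_⟩
  have hd' : MDifferentiableAt 𝓘(ℝ, ℝ) 𝓘(ℝ, E) γ s := by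
    have h2 : MDifferentiableAt 𝓘(ℝ, E) 𝓘(ℝ, E) δ.symm (δ (γ s)) :=
      hδ.smooth_symm.mdifferentiable (by simp) _
    have h3 : MDifferentiableAt 𝓘(ℝ, ℝ) 𝓘(ℝ, E) (δ.symm ∘ fun s => δ (γ s)) s := h2.comp s hd
    have e : (δ.symm ∘ fun s => δ (γ s)) = γ := funext fun s => δ.symm_apply_apply (γ s)
    exact e ▸ h3
  exact (hδ.map_hasVelocityAt (u s).2 (h.hasVelocityAt hs hd')).mfderiv_one

theorem curveLength_smul (B : LinearMap.BilinForm ℝ V₁) (t : ℝ) (u : ℝ → V₁) :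
    curveLength B (fun s => t • u s) = ENNReal.ofReal |t| * curveLength B u := by
  simp only [curveLength, sqrt_smul, ENNReal.ofReal_mul (abs_nonneg t)]
  exact lintegral_const_mul' _ _ ENNReal.ofReal_ne_top

theorem IsDilation.carnotEDist_le (B : LinearMap.BilinForm ℝ V₁) {t : ℝ} (ht : 0 < t) {δ : G ≃* G}
    (hδ : IsDilation V₁ t δ) (p q : G) :
    carnotEDist B (δ p) (δ q) ≤ ENNReal.ofReal t * carnotEDist B p q := by
  have h0 : ENNReal.ofReal t ≠ 0 := by simpa using ht
  rw [← ENNReal.inv_mul_le_iff h0 ENNReal.ofReal_ne_top, le_carnotEDist_iff]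
  rintro γ u h rfl rfl
  rw [ENNReal.inv_mul_le_iff h0 ENNReal.ofReal_ne_top]
  refine (Carnot.carnotEDist_le (h.map_dilation hδ) rfl rfl).trans_eq ?_
  rw [curveLength_smul, abs_of_pos ht]

end Distance

/-! ### Contracting families of endomorphisms, and dilations -/

/-- A continuous action of the multiplicative monoid `[0, ∞)` on `G` by endomorphisms, in which
`0` acts as the trivial endomorphism. The parameter is a real number; the values at negative
parameters are constrained by continuity and multiplicativity only. -/
structure IsContractingFamily {G : Type*} [TopologicalSpace G] [Group G]
    (D : ℝ → G → G) : Prop where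
  continuous : Continuous fun p : ℝ × G => D p.1 p.2
  map_mul : ∀ t g h, D t (g * h) = D t g * D t h
  zero : ∀ g, D 0 g = 1
  one : ∀ g, D 1 g = g
  comp : ∀ s t, 0 ≤ s → 0 ≤ t → ∀ g, D s (D t g) = D (s * t) g

section Dilations
set_option linter.unusedSectionVars false

variable {E : Type*} [NormedAddCommGroup E] [NormedSpace ℝ E] [FiniteDimensional ℝ E]
  {G : Type*} [TopologicalSpace G] [T2Space G] [ChartedSpace E G] [Group G] [LieGroup 𝓘(ℝ, E) ∞ G]
  [PreconnectedSpace G]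

/-- The dilations, extended to the parameter `0` (and, as a junk value, to negative parameters) by
the trivial endomorphism. -/
noncomputable def dilationFamily (δ : ℝ → G ≃* G) (t : ℝ) (g : G) : G := if 0 < t then δ t g else 1

variable {V : ℕ → Submodule ℝ (GroupLieAlgebra 𝓘(ℝ, E) G)} {δ : ℝ → G ≃* G}

theorem dilationFamily_of_pos {t : ℝ} (ht : 0 < t) (g : G) : dilationFamily δ t g = δ t g :=
    if_pos ht

theorem dilationFamily_of_nonpos {t : ℝ} (ht : t ≤ 0) (g : G) : dilationFamily δ t g = 1 :=
  if_neg (not_lt.2 ht)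

theorem dilationFamily_mul (t : ℝ) (g h : G) :
    dilationFamily δ t (g * h) = dilationFamily δ t g * dilationFamily δ t h := by
  unfold dilationFamily
  split_ifs <;> simp

theorem dilationFamily_inv (t : ℝ) (g : G) :
    dilationFamily δ t g⁻¹ = (dilationFamily δ t g)⁻¹ := by
  unfold dilationFamily
  split_ifs <;> simp

theorem dilationFamily_lexp (hδ : ∀ t > 0, IsDilation (V 1) t (δ t)) {v : GroupLieAlgebra 𝓘(ℝ, E) G}
    (hv : v ∈ V 1) (t s : ℝ) :
    dilationFamily δ t (lexp v s) = lexp v (max t 0 * s) := by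
  rcases lt_or_ge 0 t with ht | ht
  · rw [dilationFamily_of_pos ht, (hδ t ht).map_lexp hv, max_eq_left ht.le]
  · rw [dilationFamily_of_nonpos ht, max_eq_right ht, zero_mul, lexp_zero]

/-- Properties that hold on the horizontal one-parameter subgroups and are stable under products and
inverses hold everywhere, since the horizontal subgroup is the whole group. -/
theorem dilation_induction (hV : IsStratification V) {p : G → Prop}
    (hlexp : ∀ v ∈ V 1, ∀ s, p (lexp v s))
    (hmul : ∀ g h, p g → p h → p (g * h)) (hinv : ∀ g, p g → p g⁻¹) (g : G) : p g := by
  have hg : g ∈ horizontalSubgroup (V 1) := by rw [horizontalSubgroup_eq_top hV]; trivial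
  induction hg using Subgroup.closure_induction with
  | mem g hg => obtain ⟨v, hv, t, rfl⟩ := hg; exact hlexp v hv t
  | one => rw [← lexp_zero (0 : GroupLieAlgebra 𝓘(ℝ, E) G)]; exact hlexp 0 (zero_mem _) 0
  | mul g h _ _ ihg ihh => exact hmul g h ihg ihh
  | inv g _ ih => exact hinv g ih

theorem continuous_dilationFamily_left (hV : IsStratification V)
    (hδ : ∀ t > 0, IsDilation (V 1) t (δ t)) (g : G) :
    Continuous fun t => dilationFamily δ t g := by
  have ht : IsTopologicalGroup G := topologicalGroup_of_lieGroup 𝓘(ℝ, E) ∞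
  induction g using dilation_induction hV with
  | hlexp v hv s =>
    simp only [dilationFamily_lexp hδ hv]
    exact (contMDiff_lexp v).continuous.comp (by fun_prop)
  | hmul g h hg hh => simp only [dilationFamily_mul]; exact hg.mul hh
  | hinv g hg => simp only [dilationFamily_inv]; exact hg.inv

theorem dilationFamily_comp (hV : IsStratification V) (hδ : ∀ t > 0, IsDilation (V 1) t (δ t))
    {s t : ℝ} (hs : 0 ≤ s) (ht : 0 ≤ t) (g : G) :
    dilationFamily δ s (dilationFamily δ t g) = dilationFamily δ (s * t) g := by
  induction g using dilation_induction hV with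
  | hlexp v hv a =>
    simp only [dilationFamily_lexp hδ hv, max_eq_left hs, max_eq_left ht,
        max_eq_left (mul_nonneg hs ht), mul_assoc]
  | hmul g h hg hh => simp only [dilationFamily_mul, hg, hh]
  | hinv g hg => simp only [dilationFamily_inv, hg]

theorem dilationFamily_one_left (hV : IsStratification V) (hδ : ∀ t > 0, IsDilation (V 1) t (δ t))
    (g : G) :
    dilationFamily δ 1 g = g := by
  induction g using dilation_induction hV with
  | hlexp v hv a => simp [dilationFamily_lexp hδ hv]
  | hmul g h hg hh => simp only [dilationFamily_mul, hg, hh]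
  | hinv g hg => simp only [dilationFamily_inv, hg]

variable (B : LinearMap.BilinForm ℝ (V 1))

/-- Small dilations carry a fixed neighbourhood of the identity into any given one: the fixed one
has bounded Carnot distance from the identity, dilations scale the distance, and small Carnot
balls are small. -/
theorem exists_nhds_dilationFamily_mem (hV : IsStratification V)
    (hδ : ∀ t > 0, IsDilation (V 1) t (δ t))
    (hB_symm : ∀ v w, B v w = B w v) (hB_pos : ∀ v, v ≠ 0 → 0 < B v v) :
    ∃ N ∈ 𝓝 (1 : G), ∀ U ∈ 𝓝 (1 : G), ∃ s₀ > 0, ∀ s ≤ s₀, ∀ w ∈ N, dilationFamily δ s w ∈ U := by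
  obtain ⟨L, hL⟩ := exists_eventually_isSteerable hV B
  refine ⟨_, hL, fun U hU => ?_⟩
  obtain ⟨ε, hε, hεU⟩ := exists_carnotBall_subset B hB_symm hB_pos hU
  refine ⟨ε / (|L| + 1), by positivity, fun s hs w hw => ?_⟩
  rcases lt_or_ge 0 s with h0 | h0
  · rw [dilationFamily_of_pos h0]
    apply hεU
    have h1 := (hδ s h0).carnotEDist_le B h0 1 w
    rw [map_one] at h1
    refine (h1.trans (mul_le_mul_right hw.2.carnotEDist_le _)).trans_lt ?_
    rw [← ENNReal.ofReal_mul h0.le]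
    refine (ENNReal.ofReal_lt_ofReal_iff hε).2 ?_
    rw [le_div_iff₀ (by positivity)] at hs
    nlinarith [le_abs_self L]
  · rw [dilationFamily_of_nonpos h0]
    exact mem_of_mem_nhds hU

/-- Joint continuity of the dilations is obtained at the points `(t₀, 1)` from
`exists_nhds_dilationFamily_mem`, and at `(t₀, x₀)` by writing
`D t x = D t x₀ * D t (x₀⁻¹ * x)`. -/
theorem isContractingFamily_dilationFamily (hV : IsStratification V)
    (hδ : ∀ t > 0, IsDilation (V 1) t (δ t))
    (hB_symm : ∀ v w, B v w = B w v) (hB_pos : ∀ v, v ≠ 0 → 0 < B v v) :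
    IsContractingFamily (dilationFamily δ) := by
  refine ⟨?_, dilationFamily_mul, dilationFamily_of_nonpos le_rfl, dilationFamily_one_left hV hδ,
      fun s t hs ht =>
    dilationFamily_comp hV hδ hs ht⟩
  have ht : IsTopologicalGroup G := topologicalGroup_of_lieGroup 𝓘(ℝ, E) ∞
  obtain ⟨N, hN, hNU⟩ := exists_nhds_dilationFamily_mem B hV hδ hB_symm hB_pos
  have hequi : ∀ t₀ : ℝ, Tendsto (fun p : ℝ × G => dilationFamily δ p.1 p.2) (𝓝 (t₀, 1)) (𝓝 1) := by
    intro t₀ U hU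
    obtain ⟨s₀, hs₀, h⟩ := hNU U hU
    have hT : 0 < |t₀| + 1 := by positivity
    -- For `t < |t₀| + 1`, factor `t` as a number at most `s₀` times `(|t₀| + 1) / s₀`, and let the
    -- fixed dilation of factor `(|t₀| + 1) / s₀` bring `w` into the neighbourhood `N`.
    have h1 : ∀ᶠ p : ℝ × G in 𝓝 (t₀, 1), p.1 < |t₀| + 1 :=
      continuous_fst.continuousAt.eventually (gt_mem_nhds (by linarith [le_abs_self t₀]))
    have h2 : ∀ᶠ p : ℝ × G in 𝓝 (t₀, 1), δ ((|t₀| + 1) / s₀) p.2 ∈ N := by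
      have : Continuous fun p : ℝ × G => δ ((|t₀| + 1) / s₀) p.2 :=
        (hδ _ (by positivity)).smooth.continuous.comp continuous_snd
      exact this.continuousAt (by simpa using hN)
    change ∀ᶠ p : ℝ × G in 𝓝 (t₀, 1), dilationFamily δ p.1 p.2 ∈ U
    filter_upwards [h1, h2] with ⟨t, w⟩ h1 h2
    simp only at h1 h2
    rcases le_or_gt t 0 with h0 | h0
    · simp only [dilationFamily_of_nonpos h0]
      exact mem_of_mem_nhds hU
    · have h3 := h (t * (s₀ / (|t₀| + 1))) ?_ _ h2
      · rw [← dilationFamily_of_pos (by positivity), dilationFamily_comp hV hδ (by positivity)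
          (by positivity)] at h3
        have e : t * (s₀ / (|t₀| + 1)) * ((|t₀| + 1) / s₀) = t := by field_simp
        rwa [e] at h3
      · rw [mul_div_assoc', div_le_iff₀ hT]
        nlinarith
  rw [continuous_iff_continuousAt]
  rintro ⟨t₀, x₀⟩
  have h1 : Tendsto (fun p : ℝ × G => dilationFamily δ p.1 x₀ * dilationFamily δ p.1 (x₀⁻¹ * p.2))
      (𝓝 (t₀, x₀))
      (𝓝 (dilationFamily δ t₀ x₀ * 1)) := by
    refine Tendsto.mul ?_ ?_
    · exact ((continuous_dilationFamily_left hV hδ x₀).comp continuous_fst).continuousAt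
    · have hc : Continuous fun p : ℝ × G => (p.1, x₀⁻¹ * p.2) := by fun_prop
      have h2 := hc.tendsto (t₀, x₀)
      simp only [inv_mul_cancel] at h2
      exact (hequi t₀).comp h2
  simpa [ContinuousAt, ← dilationFamily_mul] using h1

end Dilations

/-! ### Contractibility of sets with the cone property -/

section Contractible
set_option linter.unusedSectionVars false

variable {G : Type*} [TopologicalSpace G] [Group G] [IsTopologicalGroup G] {D : ℝ → G → G}

/-- As `D 0 w * c = c` lies in the open set `C`, so does `D r w * c` for small `r`; a threshold
`(τ w)⁻¹` for `r` can be chosen continuously in `w` by a partition of unity. -/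
theorem IsContractingFamily.exists_time [T2Space G] [ParacompactSpace G]
    (hD : IsContractingFamily D) {C : Set G} (hC : IsOpen C)
    {c : G} (hc : c ∈ C) :
    ∃ τ : G → ℝ, Continuous τ ∧ (∀ w, 0 < τ w) ∧ ∀ w, ∀ r ∈ Icc 0 (τ w)⁻¹, D r w * c ∈ C := by
  let T : G → Set ℝ := fun w => {ε | 0 < ε ∧ ∀ r ∈ Icc 0 ε, D r w * c ∈ C}
  have hconv : ∀ w, Convex ℝ (T w) := by
    intro w
    rw [convex_iff_ordConnected]
    exact ⟨fun x hx y hy z hz => ⟨hx.1.trans_le hz.1, fun r hr => hy.2 r ⟨hr.1, hr.2.trans hz.2⟩⟩⟩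
  obtain ⟨f, hf⟩ := exists_continuous_forall_mem_convex_of_local_const hconv fun w => by
    have hcont : Continuous fun p : ℝ × G => D p.1 p.2 * c := hD.continuous.mul continuous_const
    have hmem : {p : ℝ × G | D p.1 p.2 * c ∈ C} ∈ 𝓝 ((0 : ℝ), w) :=
      (hC.preimage hcont).mem_nhds (by simpa [hD.zero] using hc)
    rw [nhds_prod_eq, mem_prod_iff] at hmem
    obtain ⟨I, hI, W, hW, hIW⟩ := hmem
    obtain ⟨ε, hε, hεI⟩ := Metric.mem_nhds_iff.1 hI
    refine ⟨ε / 2, ?_⟩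
    filter_upwards [hW] with w' hw'
    refine ⟨by positivity, fun r hr => hIW (show (r, w') ∈ I ×ˢ W from ⟨hεI ?_, hw'⟩)⟩
    rw [Real.ball_eq_Ioo]
    exact ⟨by linarith [hr.1], by linarith [hr.2]⟩
  refine ⟨fun w => (f w)⁻¹, f.continuous.inv₀ fun w => (hf w).1.ne', fun w => inv_pos.2 (hf w).1,
      fun w r hr => ?_⟩
  exact (hf w).2 r (by simpa using hr)

/-- A non-empty set `S` with `S C ⊆ S` is contractible. Fix `x₀ ∈ S` and `c ∈ C`, and let `σ x` be
so large that `D s (x₀⁻¹ x) D (σ x) c ∈ C` for all `s ∈ [0, 1]`. Then the identity of `S` is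
homotopic to `x ↦ x D (σ x) c` through `x D (s σ x) c`; this map is
`x ↦ x₀ D 1 (x₀⁻¹ x) D (σ x) c`, which is homotopic to `x ↦ x₀ D (σ x) c` through
`x₀ D s (x₀⁻¹ x) D (σ x) c`; and the latter is homotopic to the constant `x₀ c`. -/
theorem IsContractingFamily.contractibleSpace [T2Space G] [ParacompactSpace G]
    (hD : IsContractingFamily D) {C S : Set G} (hC : IsOpen C)
    (hCD : ∀ t > 0, ∀ c ∈ C, D t c ∈ C) (hC0 : C.Nonempty) (hS : HasConeProperty C S)
    (hS0 : S.Nonempty) :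
    ContractibleSpace S := by
  obtain ⟨c, hc⟩ := hC0
  obtain ⟨x₀, hx₀⟩ := hS0
  obtain ⟨τ, hτc, hτ0, hτ⟩ := hD.exists_time hC hc
  have hmul : ∀ x ∈ S, ∀ c ∈ C, x * c ∈ S := fun x hx c hc => hS (mul_mem_mul hx hc)
  have hτc' : Continuous fun x : S => τ (x₀⁻¹ * x) := by fun_prop
  set σ : S → ℝ := fun x => τ (x₀⁻¹ * x) with hσ
  have hσ0 : ∀ x, 0 < σ x := fun x => hτ0 _
  let f₁ : C(S, S) := ⟨fun x => ⟨x * D (σ x) c, hmul x x.2 _ (hCD _ (hσ0 x) c hc)⟩, by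
    refine Continuous.subtype_mk ?_ _
    exact continuous_subtype_val.mul (hD.continuous.comp (hτc'.prodMk continuous_const))⟩
  let f₂ : C(S, S) := ⟨fun x => ⟨x₀ * D (σ x) c, hmul x₀ hx₀ _ (hCD _ (hσ0 x) c hc)⟩, by
    refine Continuous.subtype_mk ?_ _
    exact continuous_const.mul (hD.continuous.comp (hτc'.prodMk continuous_const))⟩
  have hx₁ : x₀ * c ∈ S := hmul x₀ hx₀ c hc
  have h₁ : (ContinuousMap.id S).Homotopic f₁ := by
    refine ⟨⟨⟨fun p => ⟨p.2 * D ((p.1 : ℝ) * σ p.2) c, ?_⟩, ?_⟩, ?_, ?_⟩⟩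
    · rcases p.1.2.1.eq_or_lt with h | h
      · rw [← h, zero_mul, hD.zero, mul_one]
        exact p.2.2
      · exact hmul _ p.2.2 _ (hCD _ (mul_pos h (hσ0 _)) c hc)
    · refine Continuous.subtype_mk ?_ _
      refine (continuous_subtype_val.comp continuous_snd).mul
          (hD.continuous.comp (Continuous.prodMk ?_ continuous_const))
      exact (continuous_subtype_val.comp continuous_fst).mul (hτc'.comp continuous_snd)
    · intro x
      ext
      simp [hD.zero]
    · intro x
      ext
      simp [f₁]
  have h₂ : f₁.Homotopic f₂ := by
    have key : ∀ (s : ℝ) (x : S), D s (x₀⁻¹ * x) * D (σ x) c =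
        D (σ x) (D (s / σ x) (x₀⁻¹ * x) * c) ∨ s < 0 := by
      intro s x
      rcases lt_or_ge s 0 with h | h
      · exact Or.inr h
      · left
        rw [hD.map_mul (σ x), hD.comp _ _ (hσ0 x).le (div_nonneg h (hσ0 x).le), mul_div_cancel₀ _
            (hσ0 x).ne']
    refine ⟨⟨⟨fun p => ⟨x₀ * (D (1 - (p.1 : ℝ)) (x₀⁻¹ * p.2) * D (σ p.2) c), ?_⟩, ?_⟩, ?_, ?_⟩⟩
    · have h0 : 0 ≤ 1 - (p.1 : ℝ) := sub_nonneg.2 p.1.2.2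
      refine hmul _ hx₀ _ ?_
      rw [(key _ p.2).resolve_right (not_lt.2 h0)]
      refine hCD _ (hσ0 _) _ (hτ _ _ ⟨div_nonneg h0 (hσ0 _).le, ?_⟩)
      rw [div_eq_mul_inv]
      exact mul_le_of_le_one_left (inv_nonneg.2 (hσ0 _).le) (by linarith [p.1.2.1])
    · refine Continuous.subtype_mk ?_ _
      refine continuous_const.mul ((hD.continuous.comp (Continuous.prodMk ?_ ?_)).mul
          (hD.continuous.comp (Continuous.prodMk ?_ continuous_const)))
      · fun_prop
      · fun_prop
      · exact hτc'.comp continuous_snd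
    · intro x
      ext
      simp [f₁, hD.one, ← mul_assoc]
    · intro x
      ext
      simp [f₂, hD.zero]
  have h₃ : f₂.Homotopic (ContinuousMap.const S ⟨x₀ * c, hx₁⟩) := by
    refine ⟨⟨⟨fun p => ⟨x₀ * D ((1 - (p.1 : ℝ)) * σ p.2 + p.1) c, ?_⟩, ?_⟩, ?_, ?_⟩⟩
    · refine hmul _ hx₀ _ (hCD _ ?_ c hc)
      rcases p.1.2.1.eq_or_lt with h | h
      · rw [← h]; simpa using hσ0 _
      · have := mul_nonneg (sub_nonneg.2 p.1.2.2) (hσ0 p.2).le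
        linarith
    · refine Continuous.subtype_mk ?_ _
      refine continuous_const.mul (hD.continuous.comp (Continuous.prodMk ?_ continuous_const))
      have := hτc'.comp (continuous_snd (X := unitInterval) (Y := S))
      have h4 : Continuous fun p : unitInterval × S => (p.1 : ℝ) := by fun_prop
      exact ((continuous_const.sub h4).mul this).add h4
    · intro x
      ext
      simp [f₂]
    · intro x
      ext
      simp [hD.one]
  rw [contractible_iff_id_nullhomotopic]
  exact ⟨_, (h₁.trans h₂).trans h₃⟩

end Contractible

/-! ### Interior and closure of sets with the cone property -/

section ConeProperty
set_option linter.unusedSectionVars false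

variable {G : Type*} [TopologicalSpace G] [Group G] [IsTopologicalGroup G] {C A : Set G}

/-- The translate `a C` is an open subset of `A`. -/
theorem HasConeProperty.mul_mem_interior (hA : HasConeProperty C A) (hC : IsOpen C) {a c : G}
    (ha : a ∈ A) (hc : c ∈ C) :
    a * c ∈ interior A := by
  refine mem_interior.2 ⟨(fun x => a⁻¹ * x) ⁻¹' C, fun x hx => ?_,
      hC.preimage (by fun_prop), by simpa using hc⟩
  simpa using hA (mul_mem_mul ha hx)

theorem HasConeProperty.interior (hA : HasConeProperty C A) (hC : IsOpen C) :
    HasConeProperty C (interior A) := by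
  rintro _ ⟨a, ha, c, hc, rfl⟩
  exact hA.mul_mem_interior hC (interior_subset ha) hc

theorem HasConeProperty.compl (hA : HasConeProperty C A) : HasConeProperty C⁻¹ Aᶜ := by
  rintro _ ⟨a, ha, c, hc, rfl⟩ h
  apply ha
  simpa using hA (mul_mem_mul h hc)

/-- The interior of a set with the cone property is regularly open. If `x` is interior to the
closure of the interior of `A`, then so is `x c⁻¹` for some small `c ∈ C`; hence `x C⁻¹`, a
neighbourhood of `x c⁻¹`, meets `A`, and `x ∈ A C` is interior to `A`. -/
theorem HasConeProperty.interior_closure_interior (hA : HasConeProperty C A) (hC : IsOpen C)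
    (h1 : (1 : G) ∈ closure C) :
    _root_.interior (closure (_root_.interior A)) = _root_.interior A := by
  refine subset_antisymm (fun x hx => ?_) (interior_maximal subset_closure isOpen_interior)
  have hopen : IsOpen ((fun c => x * c⁻¹) ⁻¹' _root_.interior (closure (_root_.interior A))) :=
    isOpen_interior.preimage (by fun_prop)
  obtain ⟨c, hc, hcC⟩ := mem_closure_iff.1 h1 _ hopen (by simpa using hx)
  have hopen' : IsOpen ((fun z => z⁻¹ * x) ⁻¹' C) := hC.preimage (by fun_prop)
  obtain ⟨z, hz, hzA⟩ := mem_closure_iff.1 (interior_subset hc) _ hopen' (by simpa using hcC)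
  simpa using hA.mul_mem_interior hC (interior_subset hzA) hz

end ConeProperty

/-! ### Density points -/

section Density
set_option linter.unusedSectionVars false

variable {E : Type*} [NormedAddCommGroup E] [NormedSpace ℝ E] [FiniteDimensional ℝ E]
  {G : Type*} [TopologicalSpace G] [T2Space G] [ChartedSpace E G] [Group G] [LieGroup 𝓘(ℝ, E) ∞ G]
  {V₁ : Submodule ℝ (GroupLieAlgebra 𝓘(ℝ, E) G)} {B : LinearMap.BilinForm ℝ V₁}

theorem mem_carnotBall_iff {x y : G} {r : ℝ} :
    y ∈ carnotBall B x r ↔ x⁻¹ * y ∈ carnotBall B 1 r := by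
  simp only [carnotBall, mem_ofPred_eq]
  rw [← carnotEDist_mul_left B x⁻¹ x y, inv_mul_cancel]

theorem IsDilation.image_carnotBall_subset {t : ℝ} (ht : 0 < t) {δ : G ≃* G}
    (hδ : IsDilation V₁ t δ) (r : ℝ) : δ '' carnotBall B 1 r ⊆ carnotBall B 1 (t * r) := by
  rintro _ ⟨y, hy, rfl⟩
  have h1 := hδ.carnotEDist_le B ht 1 y
  rw [map_one] at h1
  refine h1.trans_lt ?_
  rw [ENNReal.ofReal_mul ht.le]
  exact ENNReal.mul_lt_mul_right (by simpa using ht) ENNReal.ofReal_ne_top hy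


theorem smul_carnotBall_one (x : G) (r : ℝ) : x • carnotBall B 1 r = carnotBall B x r := by
  ext y
  rw [mem_carnotBall_iff, mem_smul_set_iff_inv_smul_mem, smul_eq_mul]

variable [PreconnectedSpace G] {V : ℕ → Submodule ℝ (GroupLieAlgebra 𝓘(ℝ, E) G)} {δ : ℝ → G ≃* G}
  {B : LinearMap.BilinForm ℝ (V 1)}

theorem dilation_apply_dilation_inv (hV : IsStratification V)
    (hδ : ∀ t > 0, IsDilation (V 1) t (δ t))
    {t : ℝ} (ht : 0 < t) (g : G) : δ t (δ t⁻¹ g) = g := by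
  have h := dilationFamily_comp hV hδ ht.le (inv_pos.2 ht).le g
  rwa [mul_inv_cancel₀ ht.ne', dilationFamily_one_left hV hδ, dilationFamily_of_pos ht,
    dilationFamily_of_pos (inv_pos.2 ht)] at h

theorem image_dilation_carnotBall (hV : IsStratification V) (hδ : ∀ t > 0, IsDilation (V 1) t (δ t))
    {t : ℝ} (ht : 0 < t) (r : ℝ) : δ t '' carnotBall B 1 r = carnotBall B 1 (t * r) := by
  refine subset_antisymm ((hδ t ht).image_carnotBall_subset ht r) fun y hy => ?_
  refine ⟨δ t⁻¹ y, ?_, dilation_apply_dilation_inv hV hδ ht y⟩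
  have h := (hδ _ (inv_pos.2 ht)).image_carnotBall_subset (B := B) (inv_pos.2 ht) (t * r)
      (mem_image_of_mem _ hy)
  rwa [inv_mul_cancel_left₀ ht.ne'] at h

theorem image_dilation_mem_nhds_one (hδ : ∀ t > 0, IsDilation (V 1) t (δ t)) {t : ℝ} (ht : 0 < t)
    {S : Set G} (hS : S ∈ 𝓝 (1 : G)) : δ t '' S ∈ 𝓝 (1 : G) := by
  have h := (hδ t ht).smooth_symm.continuous.continuousAt (x := 1) (by simpa using hS)
  refine mem_of_superset h fun y hy => ⟨_, hy, by simp⟩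

/-- The ball of some radius is a neighbourhood of the identity by `exists_eventually_isSteerable`,
and dilations carry it to the ball of any other radius. -/
theorem carnotBall_mem_nhds_one (hV : IsStratification V) (hδ : ∀ t > 0, IsDilation (V 1) t (δ t))
    {r : ℝ} (hr : 0 < r) : carnotBall B 1 r ∈ 𝓝 (1 : G) := by
  obtain ⟨L, hL⟩ := exists_eventually_isSteerable hV B
  have h1 : carnotBall B 1 (|L| + 1) ∈ 𝓝 (1 : G) := by
    filter_upwards [hL] with g hg
    refine hg.2.carnotEDist_le.trans_lt ((ENNReal.ofReal_lt_ofReal_iff (by positivity)).2 ?_)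
    linarith [le_abs_self L]
  have h2 := image_dilation_mem_nhds_one hδ (t := r / (|L| + 1)) (by positivity) h1
  rwa [image_dilation_carnotBall hV hδ (by positivity), div_mul_cancel₀ _ (by positivity)] at h2

variable [MeasurableSpace G] [BorelSpace G] {μ : Measure G} [μ.IsHaarMeasure]

/-- Some ball lies in a compact set, and dilations carry it to the ball of any other radius. -/
theorem measure_carnotBall_one_lt_top (hV : IsStratification V)
    (hδ : ∀ t > 0, IsDilation (V 1) t (δ t))
    (hB_symm : ∀ v w, B v w = B w v) (hB_pos : ∀ v, v ≠ 0 → 0 < B v v) (r : ℝ) :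
    μ (carnotBall B 1 r) < ⊤ := by
  have : LocallyCompactSpace G := ChartedSpace.locallyCompactSpace E G
  obtain ⟨K, hK, hK1⟩ := exists_compact_mem_nhds (1 : G)
  obtain ⟨ε, hε, hεK⟩ := exists_carnotBall_subset B hB_symm hB_pos hK1
  rcases le_or_gt r 0 with hr | hr
  · have h0 : carnotBall B (1 : G) r = ∅ := by
      ext y
      simp [carnotBall, ENNReal.ofReal_of_nonpos hr]
    simp [h0]
  · have h := image_dilation_carnotBall (B := B) hV hδ (t := r / ε) (by positivity) ε
    rw [div_mul_cancel₀ _ hε.ne'] at h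
    rw [← h]
    exact (measure_mono (image_mono hεK)).trans_lt
      (hK.image (hδ _ (by positivity)).smooth.continuous).measure_lt_top

/-- The image of a Haar measure under a dilation is a Haar measure, so that a dilation multiplies
the measures of all sets by the same constant. -/
theorem IsDilation.exists_measure_eq_mul [SecondCountableTopology G]
    {V₁ : Submodule ℝ (GroupLieAlgebra 𝓘(ℝ, E) G)}
    {t : ℝ} {φ : G ≃* G} (hφ : IsDilation V₁ t φ) (μ : Measure G) [μ.IsHaarMeasure] :
    ∃ c : ℝ≥0∞, c ≠ 0 ∧ c ≠ ⊤ ∧ ∀ S : Set G, μ S = c * μ (φ '' S) := by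
  have : LocallyCompactSpace G := ChartedSpace.locallyCompactSpace E G
  have : IsTopologicalGroup G := topologicalGroup_of_lieGroup 𝓘(ℝ, E) ∞
  have hm : (μ.map φ).IsHaarMeasure := φ.isHaarMeasure_map μ hφ.smooth.continuous
      hφ.smooth_symm.continuous
  have h := Measure.isMulLeftInvariant_eq_smul (μ.map φ) μ
  refine ⟨Measure.haarScalarFactor (μ.map φ) μ, ?_, ENNReal.coe_ne_top, fun S => ?_⟩
  · simpa using (Measure.haarScalarFactor_pos_of_isHaarMeasure (μ.map φ) μ).ne'
  · let e : G ≃ᵐ G :=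
      (Homeomorph.mk φ.toEquiv hφ.smooth.continuous hφ.smooth_symm.continuous).toMeasurableEquiv
    have h1 : μ.map φ (φ '' S) = μ S := by
      change μ.map e (φ '' S) = μ S
      rw [e.map_apply]
      congr 1
      exact preimage_image_eq _ φ.injective
    rw [← h1]
    conv_lhs => rw [h]
    rfl

theorem one_mem_closure_of_dilation_image_eq (hV : IsStratification V)
    (hδ : ∀ t > 0, IsDilation (V 1) t (δ t))
    {C : Set G} (hC0 : C.Nonempty) (hδC : ∀ t > 0, δ t '' C = C) : (1 : G) ∈ closure C := by
  obtain ⟨c, hc⟩ := hC0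
  have h := (continuous_dilationFamily_left hV hδ c).continuousWithinAt (s := Ioi 0) (x := 0)
  rw [ContinuousWithinAt, dilationFamily_of_nonpos le_rfl] at h
  refine mem_closure_of_tendsto h ?_
  filter_upwards [self_mem_nhdsWithin] with t (ht : 0 < t)
  rw [dilationFamily_of_pos ht, ← hδC t ht]
  exact mem_image_of_mem _ hc

/-- The density points of a set `A` with the cone property are its interior points. Indeed, if `x`
is not interior to `A`, then `x C⁻¹` is disjoint from `A`; being invariant under the dilations
centred at `x`, it occupies the same positive proportion of all balls with centre `x`. -/
theorem lebesgueRepresentative_eq_interior [SecondCountableTopology G]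
    (hV : IsStratification V) (hδ : ∀ t > 0, IsDilation (V 1) t (δ t))
    (hB_symm : ∀ v w, B v w = B w v) (hB_pos : ∀ v, v ≠ 0 → 0 < B v v)
    {C A : Set G} (hC : IsOpen C) (hC0 : C.Nonempty) (hδC : ∀ t > 0, δ t '' C = C)
    (hA : HasConeProperty C A) : lebesgueRepresentative B μ A = interior A := by
  have htg : IsTopologicalGroup G := topologicalGroup_of_lieGroup 𝓘(ℝ, E) ∞
  have hball0 : ∀ r > 0, ∀ x : G, μ (carnotBall B x r) ≠ 0 := fun r hr x => by
    rw [← smul_carnotBall_one, measure_smul]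
    exact (MeasureTheory.Measure.measure_pos_of_mem_nhds μ (carnotBall_mem_nhds_one hV hδ hr)).ne'
  have hball1 : ∀ (r : ℝ) (x : G), μ (carnotBall B x r) ≠ ⊤ := fun r x => by
    rw [← smul_carnotBall_one, measure_smul]
    exact (measure_carnotBall_one_lt_top hV hδ hB_symm hB_pos r).ne
  have h1 : (1 : G) ∈ closure C := one_mem_closure_of_dilation_image_eq hV hδ hC0 hδC
  have hδC' : ∀ t > 0, δ t '' C⁻¹ = C⁻¹ := fun t ht => by rw [image_inv, hδC t ht]
  refine subset_antisymm (fun x hx => ?_) fun x hx => ?_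
  · by_contra hxA
    have hdisj : Disjoint A (x • C⁻¹) := by
      rw [Set.disjoint_left]
      intro a ha ha'
      rw [mem_smul_set_iff_inv_smul_mem, Set.mem_inv, smul_eq_mul, mul_inv_rev, inv_inv] at ha'
      exact hxA (by simpa using hA.mul_mem_interior hC ha ha')
    -- `k / b` is the proportion of the balls centred at `x` that is occupied by `x C⁻¹`.
    set b := μ (carnotBall B 1 1) with hb
    set k := μ (carnotBall B 1 1 ∩ C⁻¹) with hk
    have hk0 : k ≠ 0 := by
      -- The cone `C` has points near its vertex, so `C⁻¹` meets the interior of the unit ball.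
      obtain ⟨c, hc, hcC⟩ := mem_closure_iff_nhds.1 h1 (interior (carnotBall B 1 1))⁻¹
        ((isOpen_interior.inv).mem_nhds (by
          simpa using mem_interior_iff_mem_nhds.2 (carnotBall_mem_nhds_one (B := B) hV hδ one_pos)))
      have h3 : (interior (carnotBall B 1 1) ∩ C⁻¹).Nonempty :=
          ⟨c⁻¹, by simpa using hc, by simpa using hcC⟩
      exact ((isOpen_interior.inter hC.inv).measure_pos μ h3).ne' ∘ fun h =>
        measure_mono_null (inter_subset_inter_left _ interior_subset) h
    have hratio : ∀ r > 0, μ (carnotBall B x r ∩ A) / μ (carnotBall B x r) + k / b ≤ 1 := by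
      intro r hr
      obtain ⟨c, hc0, hc1, hc⟩ := (hδ r hr).exists_measure_eq_mul μ
      have e1 : b = c * μ (carnotBall B x r) := by
        rw [hb, hc, image_dilation_carnotBall hV hδ hr, mul_one, ← smul_carnotBall_one x,
            measure_smul]
      have e2 : k = c * μ (carnotBall B x r ∩ x • C⁻¹) := by
        rw [hk, hc, image_inter (δ r).injective, image_dilation_carnotBall hV hδ hr, hδC' r hr,
          mul_one,
          ← smul_carnotBall_one x, ← smul_set_inter, measure_smul]
      rw [e1, e2, ENNReal.mul_div_mul_left _ _ hc0 hc1, ENNReal.div_add_div_same]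
      refine ENNReal.div_le_of_le_mul ?_
      rw [one_mul, add_comm, ← measure_inter_add_sdiff (carnotBall B x r)
          (hC.inv.smul x).measurableSet]
      gcongr
      rintro y ⟨hy, hyA⟩
      exact ⟨hy, fun hy' => Set.disjoint_left.1 hdisj hyA hy'⟩
    have hlim : (1 : ℝ≥0∞) + k / b ≤ 1 := by
      have hx' : Tendsto (fun r : ℝ => μ (carnotBall B x r ∩ A) / μ (carnotBall B x r)) (𝓝[>] 0)
          (𝓝 1) := hx
      refine le_of_tendsto (hx'.add_const (k / b)) ?_
      filter_upwards [self_mem_nhdsWithin] with r hr using hratio r hr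
    have hkb : k / b ≠ 0 := ENNReal.div_ne_zero.2 ⟨hk0, hball1 1 1⟩
    exact hlim.not_gt (ENNReal.lt_add_right ENNReal.one_ne_top hkb)
  · have hU : (x⁻¹ • A) ∈ 𝓝 (1 : G) := by
      have h2 := smul_mem_nhds_smul x⁻¹ (mem_interior_iff_mem_nhds.1 hx)
      simpa using h2
    obtain ⟨ε, hε, hεU⟩ := exists_carnotBall_subset B hB_symm hB_pos hU
    refine tendsto_const_nhds.congr' ?_
    filter_upwards [Ioo_mem_nhdsGT hε] with r hr
    have hsub : carnotBall B x r ⊆ A := by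
      intro y hy
      rw [mem_carnotBall_iff] at hy
      have h3 := hεU (show x⁻¹ * y ∈ carnotBall B 1 ε from
        lt_of_lt_of_le hy (ENNReal.ofReal_le_ofReal hr.2.le))
      simpa [mem_smul_set_iff_inv_smul_mem] using h3
    rw [inter_eq_left.2 hsub, ENNReal.div_self (hball0 r hr.1 x) (hball1 r x)]

end Density
end Carnot

theorem mainTheorem3
    {E : Type*} [NormedAddCommGroup E] [NormedSpace ℝ E] [FiniteDimensional ℝ E]
    {G : Type*} [TopologicalSpace G] [T2Space G] [SecondCountableTopology G]
    [ChartedSpace E G] [Group G] [LieGroup 𝓘(ℝ, E) ∞ G] [SimplyConnectedSpace G]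
    [MeasurableSpace G] [BorelSpace G]
    (V : ℕ → Submodule ℝ (GroupLieAlgebra 𝓘(ℝ, E) G)) (hV : Carnot.IsStratification V)
    (B : LinearMap.BilinForm ℝ (V 1)) (hB_symm : ∀ v w, B v w = B w v)
    (hB_pos : ∀ v, v ≠ 0 → 0 < B v v)
    (μ : Measure G) [μ.IsHaarMeasure]
    (C : Set G) (hC : Carnot.IsCone (V 1) C) (hC_open : IsOpen C)
    (A : Set G) (hA : NullMeasurableSet A μ) (hAC : Carnot.HasConeProperty C A) :
    IsOpen (Carnot.lebesgueRepresentative B μ A) ∧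
    Carnot.lebesgueRepresentative B μ A =
      interior (closure (Carnot.lebesgueRepresentative B μ A)) ∧
    (A.Nonempty → ContractibleSpace ↥(Carnot.lebesgueRepresentative B μ A)) ∧
    (A ≠ univ → ContractibleSpace ↥(Carnot.lebesgueRepresentative B μ A)ᶜ) := by
  -- The dilations are given for each `t > 0` separately; the values at `t ≤ 0` are irrelevant.
  have hexists : ∀ t : ℝ, ∃ δ : G ≃* G, 0 < t → Carnot.IsDilation (V 1) t δ ∧ δ '' C = C := by
    intro t
    rcases lt_or_ge 0 t with ht | ht
    · exact (hC.2 t ht).imp fun _ h _ => h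
    · exact ⟨MulEquiv.refl G, fun h => absurd h ht.not_gt⟩
  choose δ hδ' using hexists
  have hδ : ∀ t > 0, Carnot.IsDilation (V 1) t (δ t) := fun t ht => (hδ' t ht).1
  have hδC : ∀ t > 0, δ t '' C = C := fun t ht => (hδ' t ht).2
  have htg : IsTopologicalGroup G := topologicalGroup_of_lieGroup 𝓘(ℝ, E) ∞
  have : LocallyCompactSpace G := ChartedSpace.locallyCompactSpace E G
  have hD := Carnot.isContractingFamily_dilationFamily B hV hδ hB_symm hB_pos
  have hDC : ∀ t > 0, ∀ c ∈ C, Carnot.dilationFamily δ t c ∈ C := fun t ht c hc => by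
    rw [Carnot.dilationFamily_of_pos ht, ← hδC t ht]
    exact mem_image_of_mem _ hc
  have hDC' : ∀ t > 0, ∀ c ∈ C⁻¹, Carnot.dilationFamily δ t c ∈ C⁻¹ := fun t ht c hc => by
    rw [Set.mem_inv, ← Carnot.dilationFamily_inv]
    exact hDC t ht _ hc
  rw [Carnot.lebesgueRepresentative_eq_interior hV hδ hB_symm hB_pos hC_open hC.1 hδC hAC]
  refine ⟨isOpen_interior, (hAC.interior_closure_interior hC_open
    (Carnot.one_mem_closure_of_dilation_image_eq hV hδ hC.1 hδC)).symm,
    fun hA0 => ?_, fun hA1 => ?_⟩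
  · refine hD.contractibleSpace hC_open hDC hC.1 (hAC.interior hC_open) ?_
    obtain ⟨a, ha⟩ := hA0
    obtain ⟨c, hc⟩ := hC.1
    exact ⟨a * c, hAC.mul_mem_interior hC_open ha hc⟩
  -- The complement has the cone property for the cone `C⁻¹`.
  · refine hD.contractibleSpace hC_open.inv hDC' hC.1.inv (hAC.interior hC_open).compl ?_
    rw [nonempty_compl]
    exact fun h => hA1 (interior_eq_univ.1 h)
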